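/- Let $n \ge 4$ and let $G_1=(V,E_1)$ and $G_2=(V,E_2)$ be two graphs on a common set $V$ of $n$ vertices, each of which is 2-page book embeddable, that is, its vertices can be linearly ordered and its edges partitioned into two pages so that no two edges on the same page have ends that alternate in the order. (The two orders may be different.) Then $G_1$ and $G_2$ admit a RAC simultaneous drawing with at most four bends per edge on an integer grid of size $(11n-32)\times(11n-32)$. Explicitly: the vertices can be placed at distinct points of the plane, and for $i=1,2$ every edge of $E_i$ can be drawn as a polyline with at most four bends joining its two ends, with all vertices and bends at points of the integer grid with $11n-32$ columns and $11n-32$ rows, in such a way that (i) for each $i$ the drawing of $G_i$ is planar (its edges are simple arcs that pass through no vertices except their own ends, and two distinct edges meet only in common end vertices); (ii) no edge of $E_1$ overlaps an edge of $E_2$, that is, they share no segment of positive length; (iii) wherever an edge of $E_1$ and an edge of $E_2$ meet, other than in a common end vertex, they cross at a right angle, in the interior of a segment of each. An edge in $E_1\cap E_2$ is drawn once for each graph, and these two curves may be different. -/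

import Mathlib

/-- The Euclidean plane, as pairs of real coordinates. -/
abbrev Plane : Type := ℝ × ℝ

/-- The segments of the polyline through the listed points. -/
def polySegments (L : List Plane) : List (Plane × Plane) := L.zip L.tail

/-- The set of points covered by the polyline through the listed points. -/
def polyTrace : List Plane → Set Plane
  | [] => ∅
  | [p] => {p}
  | p :: q :: r => segment ℝ p q ∪ polyTrace (q :: r)

/-- The polyline is a simple arc: no segment is degenerate, and each segment meets the rest of the
polyline after it only in the point where that rest begins. -/
def IsSimplePolyline : List Plane → Prop
  | [] => True
  | [_] => True
  | p :: q :: r =>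
      p ≠ q ∧ (∀ x, x ∈ segment ℝ p q → x ∈ polyTrace (q :: r) → x = q) ∧ IsSimplePolyline (q :: r)

/-- Two segments with orthogonal directions. -/
def SegPerp (s t : Plane × Plane) : Prop :=
  (s.2.1 - s.1.1) * (t.2.1 - t.1.1) + (s.2.2 - s.1.2) * (t.2.2 - t.1.2) = 0

/-- At the point `x`, the polylines `L` and `M` cross at a right angle: `x` is interior to a segment
of each, and these two segments are perpendicular. -/
def IsRightAngleCrossing (L M : List Plane) (x : Plane) : Prop :=
  ∃ s ∈ polySegments L, ∃ t ∈ polySegments M,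
    x ∈ openSegment ℝ s.1 s.2 ∧ x ∈ openSegment ℝ t.1 t.2 ∧ SegPerp s t

/-- The polyline that draws the edge from `u` to `v`: the vertex `u`, the bends, the vertex `v`. -/
def edgePolyline {V : Type*} (pos : V → Plane) (bends : V → V → List Plane) (u v : V) :
    List Plane :=
  pos u :: (bends u v ++ [pos v])

/-- The vertex placement `pos` and the lists of bends (`bends u v` from `u` to `v`) give a planar
polyline drawing of `G`. The vertices of the drawing are all of `V`. -/
structure IsPlanarPolylineDrawing {V : Type*} (G : SimpleGraph V) (pos : V → Plane)
    (bends : V → V → List Plane) : Prop where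
  /-- Distinct vertices are placed at distinct points. -/
  pos_injective : Function.Injective pos
  /-- The two directions of an edge give the same curve. -/
  bends_symm : ∀ u v, G.Adj u v → bends v u = (bends u v).reverse
  /-- No edge meets itself. -/
  simple : ∀ u v, G.Adj u v → IsSimplePolyline (edgePolyline pos bends u v)
  /-- No edge passes through a vertex other than its ends. -/
  vertex_on_edge : ∀ u v w, G.Adj u v → pos w ∈ polyTrace (edgePolyline pos bends u v) →
    w = u ∨ w = v
  /-- Distinct edges meet only in common end vertices. -/
  edges_disjoint : ∀ u v u' v', G.Adj u v → G.Adj u' v' → s(u, v) ≠ s(u', v') →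
    ∀ x, x ∈ polyTrace (edgePolyline pos bends u v) →
      x ∈ polyTrace (edgePolyline pos bends u' v') →
      ∃ w, w ∈ s(u, v) ∧ w ∈ s(u', v') ∧ x = pos w

/-- A RAC simultaneous drawing of two graphs on the same vertex set: one placement of the vertices,
and for each graph its own polylines for the edges. An edge that belongs to both graphs is drawn
once for each of them. -/
structure RacSimDrawing {V : Type*} (G₁ G₂ : SimpleGraph V) where
  /-- The common placement of the vertices. -/
  pos : V → Plane
  /-- The bends of the edges of the first graph. -/
  bends₁ : V → V → List Plane
  /-- The bends of the edges of the second graph. -/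
  bends₂ : V → V → List Plane
  /-- The first graph is drawn planar. -/
  planar₁ : IsPlanarPolylineDrawing G₁ pos bends₁
  /-- The second graph is drawn planar. -/
  planar₂ : IsPlanarPolylineDrawing G₂ pos bends₂
  /-- An edge of the first graph and an edge of the second have no nondegenerate segment
  in common. -/
  no_overlap : ∀ u v u' v', G₁.Adj u v → G₂.Adj u' v' → ∀ p q : Plane,
    segment ℝ p q ⊆ polyTrace (edgePolyline pos bends₁ u v) →
    segment ℝ p q ⊆ polyTrace (edgePolyline pos bends₂ u' v') → p = q
  /-- Wherever an edge of the first graph and an edge of the second meet, other than in a common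
  end vertex, they cross at a right angle. -/
  right_angle : ∀ u v u' v', G₁.Adj u v → G₂.Adj u' v' →
    ∀ x, x ∈ polyTrace (edgePolyline pos bends₁ u v) →
      x ∈ polyTrace (edgePolyline pos bends₂ u' v') →
      (∃ w, w ∈ s(u, v) ∧ w ∈ s(u', v') ∧ x = pos w) ∨
        IsRightAngleCrossing (edgePolyline pos bends₁ u v) (edgePolyline pos bends₂ u' v') x

/-- Every edge of either graph is drawn with at most `k` bends. -/
def RacSimDrawing.HasAtMostBends {V : Type*} {G₁ G₂ : SimpleGraph V} (D : RacSimDrawing G₁ G₂)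
    (k : ℕ) : Prop :=
  (∀ u v, G₁.Adj u v → (D.bends₁ u v).length ≤ k) ∧
    (∀ u v, G₂.Adj u v → (D.bends₂ u v).length ≤ k)

/-- `p` is a point of the integer grid with `w` columns and `h` rows. -/
def IsGridPoint (w h : ℕ) (p : Plane) : Prop :=
  ∃ i j : ℕ, 1 ≤ i ∧ i ≤ w ∧ 1 ≤ j ∧ j ≤ h ∧ p = ((i : ℝ), (j : ℝ))

/-- The drawing lies on the integer grid with `w` columns and `h` rows: all vertices and all bends
are grid points. -/
def RacSimDrawing.IsOnGrid {V : Type*} {G₁ G₂ : SimpleGraph V} (D : RacSimDrawing G₁ G₂)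
    (w h : ℕ) : Prop :=
  (∀ v, IsGridPoint w h (D.pos v)) ∧
    (∀ u v, G₁.Adj u v → ∀ p ∈ D.bends₁ u v, IsGridPoint w h p) ∧
    (∀ u v, G₂.Adj u v → ∀ p ∈ D.bends₂ u v, IsGridPoint w h p)

/-- `G` has a book embedding with `k` pages: a linear order of the vertices along the spine and an
assignment of the edges to `k` pages such that no two edges on the same page cross, that is, have
ends that alternate along the spine. -/
def IsBookEmbeddable {V : Type*} [Fintype V] (G : SimpleGraph V) (k : ℕ) : Prop :=
  ∃ (spine : V ≃ Fin (Fintype.card V)) (page : Sym2 V → Fin k),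
    ∀ a b c d, G.Adj a b → G.Adj c d →
      spine a < spine c → spine c < spine b → spine b < spine d → page s(a, b) ≠ page s(c, d)

/-!
Each graph is drawn on its own axis. For the first graph, the spine of its book embedding runs from
left to right, and every vertex owns an interval of columns around its own. An edge of the upper
page leaves each of its two ends by a stem that is slanted over one row, to a column on the right
of the vertex, and then vertical; the two stems are joined by a horizontal bar above all vertices.
Edges of the lower page are drawn below, with stems that start to the left. The heights of the
vertices do not matter for planarity, which depends only on the order of the columns and of the
bars (`ColumnLayout`, `ColumnLayout.isPlanarPolylineDrawing`): around a vertex the stems are sorted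
by the cyclic order of the other ends along the spine, and the bar of an edge is at a height given
by its length along the spine (`column_not_mem_uIcc`).

The second graph is drawn in the same way and turned by a quarter, so that its spine fixes the
heights that the first drawing leaves open. The stems of the two graphs at one vertex then lie in
four different quadrants. At distinct vertices, the slanted part of a stem stays in the rows and
columns of its own vertex, so that the two graphs cross only where a vertical part of a stem of
one meets a horizontal part of a stem of the other (`ColumnLayout.Fits.right_angle`). Two segments
at a right angle share at most one point, so there is no overlap either.

The grid has as many columns as the vertices of the first graph own, plus one for every length of
an edge of the second graph on each of its pages. For `n ≥ 6` all sides of the convex polygon of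
the vertices are put on the upper page. There are then at most `2 n - 3` edges above and `n - 3`
below (`card_add_two_le`), which gives at most `9 n - 28` columns for the vertices and `2 n - 4` for
the bars. For `n = 5` one pair of vertices is not joined, and a better distribution of the other
nine possible edges gives the same bounds. For `n = 4` there is room for a drawing without any
crossings, in which every edge of the complete graph is drawn twice.
-/

/-! ### Segments and polylines in coordinates -/

theorem mem_segment_coord {p q x : Plane} :
    x ∈ segment ℝ p q ↔ ∃ t : ℝ, 0 ≤ t ∧ t ≤ 1 ∧
      x.1 = p.1 + t * (q.1 - p.1) ∧ x.2 = p.2 + t * (q.2 - p.2) := by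
  rw [segment_eq_image']
  constructor
  · rintro ⟨t, ⟨h0, h1⟩, rfl⟩
    exact ⟨t, h0, h1, by simp, by simp⟩
  · rintro ⟨t, h0, h1, hx, hy⟩
    exact ⟨t, ⟨h0, h1⟩, Prod.ext (by simp [hx]) (by simp [hy])⟩

theorem mem_openSegment_coord {p q x : Plane} :
    x ∈ openSegment ℝ p q ↔ ∃ t : ℝ, 0 < t ∧ t < 1 ∧
      x.1 = p.1 + t * (q.1 - p.1) ∧ x.2 = p.2 + t * (q.2 - p.2) := by
  rw [openSegment_eq_image']
  constructor
  · rintro ⟨t, ⟨h0, h1⟩, rfl⟩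
    exact ⟨t, h0, h1, by simp, by simp⟩
  · rintro ⟨t, h0, h1, hx, hy⟩
    exact ⟨t, ⟨h0, h1⟩, Prod.ext (by simp [hx]) (by simp [hy])⟩

/-- A vertical segment. -/
theorem mem_segment_vertical {a b c : ℝ} {x : Plane} (h : x ∈ segment ℝ (a, b) (a, c)) :
    x.1 = a ∧ min b c ≤ x.2 ∧ x.2 ≤ max b c := by
  obtain ⟨t, h0, h1, hx, hy⟩ := mem_segment_coord.1 h
  simp only at hx hy
  refine ⟨by linarith, ?_, ?_⟩
  · rcases le_total b c with hbc | hbc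
    · rw [min_eq_left hbc]; nlinarith
    · rw [min_eq_right hbc]; nlinarith
  · rcases le_total b c with hbc | hbc
    · rw [max_eq_right hbc]; nlinarith
    · rw [max_eq_left hbc]; nlinarith

/-- A horizontal segment. -/
theorem mem_segment_horizontal {a b c : ℝ} {x : Plane} (h : x ∈ segment ℝ (a, c) (b, c)) :
    x.1 ∈ Set.uIcc a b ∧ x.2 = c := by
  obtain ⟨t, h0, h1, hx, hy⟩ := mem_segment_coord.1 h
  simp only at hx hy
  refine ⟨?_, by linarith⟩
  rw [Set.mem_uIcc]
  rcases le_total a b with hab | hab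
  · left; constructor <;> nlinarith
  · right; constructor <;> nlinarith

theorem mem_openSegment_vertical {a b c : ℝ} {x : Plane} (hx : x.1 = a)
    (h : b < x.2 ∧ x.2 < c ∨ c < x.2 ∧ x.2 < b) : x ∈ openSegment ℝ (a, b) (a, c) := by
  rw [mem_openSegment_coord]
  have hne : c - b ≠ 0 := by rcases h with h | h <;> intro h' <;> linarith
  refine ⟨(x.2 - b) / (c - b), ?_, ?_, by simp [hx], by field_simp; ring⟩
  · rcases h with h | h
    · exact div_pos (by linarith) (by linarith)
    · exact div_pos_of_neg_of_neg (by linarith) (by linarith)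
  · rcases h with h | h
    · rw [div_lt_one (by linarith)]; linarith
    · rw [div_lt_one_of_neg (by linarith)]; linarith

/-- Two perpendicular segments have at most one point in common: the difference of two common
points is parallel to both, hence orthogonal to itself. -/
theorem SegPerp.eq_of_mem {s t : Plane × Plane} (h : SegPerp s t) {x y : Plane}
    (hxs : x ∈ openSegment ℝ s.1 s.2) (hxt : x ∈ openSegment ℝ t.1 t.2)
    (hys : y ∈ openSegment ℝ s.1 s.2) (hyt : y ∈ openSegment ℝ t.1 t.2) : x = y := by
  obtain ⟨a, -, -, ha, ha'⟩ := mem_openSegment_coord.1 hxs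
  obtain ⟨b, -, -, hb, hb'⟩ := mem_openSegment_coord.1 hxt
  obtain ⟨c, -, -, hc, hc'⟩ := mem_openSegment_coord.1 hys
  obtain ⟨d, -, -, hd, hd'⟩ := mem_openSegment_coord.1 hyt
  unfold SegPerp at h
  have h1 : x.1 - y.1 = (a - c) * (s.2.1 - s.1.1) := by rw [ha, hc]; ring
  have h2 : x.2 - y.2 = (a - c) * (s.2.2 - s.1.2) := by rw [ha', hc']; ring
  have h3 : x.1 - y.1 = (b - d) * (t.2.1 - t.1.1) := by rw [hb, hd]; ring
  have h4 : x.2 - y.2 = (b - d) * (t.2.2 - t.1.2) := by rw [hb', hd']; ring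
  have h5 : (x.1 - y.1) * (x.1 - y.1) + (x.2 - y.2) * (x.2 - y.2) = 0 := by
    calc (x.1 - y.1) * (x.1 - y.1) + (x.2 - y.2) * (x.2 - y.2)
        = ((a - c) * (s.2.1 - s.1.1)) * ((b - d) * (t.2.1 - t.1.1)) +
          ((a - c) * (s.2.2 - s.1.2)) * ((b - d) * (t.2.2 - t.1.2)) := by
          rw [← h1, ← h2, ← h3, ← h4]
      _ = (a - c) * (b - d) * ((s.2.1 - s.1.1) * (t.2.1 - t.1.1) +
          (s.2.2 - s.1.2) * (t.2.2 - t.1.2)) := by ring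
      _ = 0 := by rw [h, mul_zero]
  have h6 := mul_self_add_mul_self_eq_zero.1 h5
  exact Prod.ext (by linarith [h6.1]) (by linarith [h6.2])

/-- Two polylines cross at right angles in finitely many points only. -/
theorem finite_isRightAngleCrossing (L M : List Plane) :
    {x | IsRightAngleCrossing L M x}.Finite := by
  have : {x | IsRightAngleCrossing L M x} ⊆
      ⋃ s ∈ {s | s ∈ polySegments L}, ⋃ t ∈ {t | t ∈ polySegments M},
        {x | x ∈ openSegment ℝ s.1 s.2 ∧ x ∈ openSegment ℝ t.1 t.2 ∧ SegPerp s t} := by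
    rintro x ⟨s, hs, t, ht, h⟩
    simp only [Set.mem_iUnion]
    exact ⟨s, hs, t, ht, h⟩
  refine Set.Finite.subset ?_ this
  refine (List.finite_toSet _).biUnion fun s _ => (List.finite_toSet _).biUnion fun t _ => ?_
  exact Set.Subsingleton.finite fun x hx y hy => hx.2.2.eq_of_mem hx.1 hx.2.1 hy.1 hy.2.1

theorem eq_of_segment_subset_finite {p q : Plane} {S : Set Plane} (hS : S.Finite)
    (h : segment ℝ p q ⊆ S) : p = q := by
  have h1 : (segment ℝ p q).Finite := hS.subset h
  have h2 : IsPreconnected (segment ℝ p q) := (convex_segment p q).isPreconnected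
  exact (h2.isDiscrete_iff_subsingleton.1 h1.isDiscrete) (left_mem_segment ℝ p q) (right_mem_segment ℝ p q)

/-- If two families of curves meet only in common end vertices and in right-angle crossings, then
they do not overlap, because these points are finitely many for each pair of curves. -/
theorem no_overlap_of_right_angle {V : Type*} {G₁ G₂ : SimpleGraph V} {pos : V → Plane}
    {b₁ b₂ : V → V → List Plane}
    (h : ∀ u v u' v', G₁.Adj u v → G₂.Adj u' v' →
      ∀ x, x ∈ polyTrace (edgePolyline pos b₁ u v) →
        x ∈ polyTrace (edgePolyline pos b₂ u' v') →
        (∃ w, w ∈ s(u, v) ∧ w ∈ s(u', v') ∧ x = pos w) ∨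
          IsRightAngleCrossing (edgePolyline pos b₁ u v) (edgePolyline pos b₂ u' v') x) :
    ∀ u v u' v', G₁.Adj u v → G₂.Adj u' v' → ∀ p q : Plane,
      segment ℝ p q ⊆ polyTrace (edgePolyline pos b₁ u v) →
      segment ℝ p q ⊆ polyTrace (edgePolyline pos b₂ u' v') → p = q := by
  intro u v u' v' huv huv' p q h1 h2
  refine eq_of_segment_subset_finite (S := {pos u, pos v} ∪ {x | IsRightAngleCrossing
    (edgePolyline pos b₁ u v) (edgePolyline pos b₂ u' v') x})
    ((Set.toFinite _).union (finite_isRightAngleCrossing _ _)) fun x hx => ?_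
  rcases h u v u' v' huv huv' x (h1 hx) (h2 hx) with ⟨w, hw, -, rfl⟩ | hc
  · rcases Sym2.mem_iff.1 hw with rfl | rfl <;> simp
  · exact Or.inr hc

/-! ### Rotating a drawing by a quarter turn -/

/-- The clockwise quarter turn `(x, y) ↦ (y, C - x)`. -/
def quarterTurn (C : ℝ) (p : Plane) : Plane := (p.2, C - p.1)

/-- The inverse of `quarterTurn C`. -/
def quarterTurnInv (C : ℝ) (p : Plane) : Plane := (C - p.2, p.1)

theorem quarterTurn_inv (C : ℝ) (p : Plane) : quarterTurn C (quarterTurnInv C p) = p := by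
  simp [quarterTurn, quarterTurnInv]

theorem quarterTurnInv_turn (C : ℝ) (p : Plane) : quarterTurnInv C (quarterTurn C p) = p := by
  simp [quarterTurn, quarterTurnInv]

theorem quarterTurn_injective (C : ℝ) : Function.Injective (quarterTurn C) :=
  Function.LeftInverse.injective (quarterTurnInv_turn C)

theorem mem_segment_quarterTurn (C : ℝ) (p q x : Plane) :
    x ∈ segment ℝ (quarterTurn C p) (quarterTurn C q) ↔
      quarterTurnInv C x ∈ segment ℝ p q := by
  simp only [mem_segment_coord, quarterTurn, quarterTurnInv]
  constructor
  · rintro ⟨t, h0, h1, h2, h3⟩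
    exact ⟨t, h0, h1, by linarith, by linarith⟩
  · rintro ⟨t, h0, h1, h2, h3⟩
    exact ⟨t, h0, h1, by linarith, by linarith⟩

theorem mem_polyTrace_quarterTurn (C : ℝ) (x : Plane) : ∀ L : List Plane,
    x ∈ polyTrace (L.map (quarterTurn C)) ↔ quarterTurnInv C x ∈ polyTrace L
  | [] => by simp [polyTrace]
  | [p] => by
      simp only [List.map_cons, List.map_nil, polyTrace, Set.mem_singleton_iff]
      constructor
      · rintro rfl; exact quarterTurnInv_turn C p
      · rintro rfl; exact (quarterTurn_inv C x).symm
  | p :: q :: r => by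
      have ih := mem_polyTrace_quarterTurn C x (q :: r)
      simp only [List.map_cons] at ih ⊢
      simp only [polyTrace, Set.mem_union, mem_segment_quarterTurn, ih]

theorem IsSimplePolyline.map_quarterTurn (C : ℝ) : ∀ {L : List Plane}, IsSimplePolyline L →
    IsSimplePolyline (L.map (quarterTurn C))
  | [], _ => trivial
  | [_], _ => trivial
  | p :: q :: r, ⟨hpq, hx, hr⟩ => by
      refine ⟨fun h => hpq (quarterTurn_injective C h), fun x h1 h2 => ?_,
        hr.map_quarterTurn C⟩
      rw [mem_segment_quarterTurn] at h1
      have h3 := hx _ h1 ((mem_polyTrace_quarterTurn C x (q :: r)).1 h2)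
      rw [← h3, quarterTurn_inv]

theorem edgePolyline_quarterTurn {V : Type*} (C : ℝ) (pos : V → Plane)
    (bends : V → V → List Plane) (u v : V) :
    edgePolyline (fun w => quarterTurn C (pos w))
      (fun a b => (bends a b).map (quarterTurn C)) u v =
      (edgePolyline pos bends u v).map (quarterTurn C) := by
  simp [edgePolyline]

theorem IsPlanarPolylineDrawing.quarterTurn {V : Type*} {G : SimpleGraph V} {pos : V → Plane}
    {bends : V → V → List Plane} (h : IsPlanarPolylineDrawing G pos bends) (C : ℝ) :
    IsPlanarPolylineDrawing G (fun w => quarterTurn C (pos w))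
      (fun a b => (bends a b).map (quarterTurn C)) where
  pos_injective := (quarterTurn_injective C).comp h.pos_injective
  bends_symm u v huv := by simp only [h.bends_symm u v huv, List.map_reverse]
  simple u v huv := by
    rw [edgePolyline_quarterTurn]
    exact (h.simple u v huv).map_quarterTurn C
  vertex_on_edge u v w huv hw := by
    rw [edgePolyline_quarterTurn, mem_polyTrace_quarterTurn, quarterTurnInv_turn] at hw
    exact h.vertex_on_edge u v w huv hw
  edges_disjoint u v u' v' huv huv' hne x hx hx' := by
    rw [edgePolyline_quarterTurn, mem_polyTrace_quarterTurn] at hx hx'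
    obtain ⟨w, h1, h2, h3⟩ := h.edges_disjoint u v u' v' huv huv' hne _ hx hx'
    exact ⟨w, h1, h2, by rw [← h3, quarterTurn_inv]⟩

/-! ### Stems -/

/-- The stem from the vertex `(a, b)` through the bend `(c, b + s)` to the point `(c, h)`, where
`s = 1` for a stem that goes up and `s = -1` for one that goes down: it is slanted over a height
of one, then vertical. -/
structure OnStem (a b c h s : ℝ) (x : Plane) : Prop where
  base_le : 0 ≤ s * (x.2 - b)
  le_far : s * x.2 ≤ s * h
  slanted : s * (x.2 - b) ≤ 1 → x.1 = a + s * (x.2 - b) * (c - a)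
  vertical : 1 ≤ s * (x.2 - b) → x.1 = c

section Stem

variable {a b c h s : ℝ} {x : Plane}

theorem onStem_of_mem_slanted (hs : s = 1 ∨ s = -1) (hh : 1 ≤ s * (h - b))
    (hx : x ∈ segment ℝ (a, b) (c, b + s)) : OnStem a b c h s x ∧ s * (x.2 - b) ≤ 1 := by
  obtain ⟨t, h0, h1, hx1, hx2⟩ := mem_segment_coord.1 hx
  simp only [add_sub_cancel_left] at hx1 hx2
  have hss : s * s = 1 := by rcases hs with rfl | rfl <;> norm_num
  have ht : s * (x.2 - b) = t := by rw [hx2]; linear_combination t * hss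
  refine ⟨⟨by rw [ht]; exact h0, ?_, fun _ => by rw [ht, hx1], fun h' => ?_⟩, by rw [ht]; exact h1⟩
  · linarith
  · rw [ht] at h'
    have : t = 1 := le_antisymm h1 h'
    rw [hx1, this]; ring

theorem onStem_of_mem_vertical (hs : s = 1 ∨ s = -1) (hh : 1 ≤ s * (h - b))
    (hx : x ∈ segment ℝ (c, b + s) (c, h)) :
    OnStem a b c h s x ∧ 1 ≤ s * (x.2 - b) := by
  obtain ⟨hx1, h2, h3⟩ := mem_segment_vertical hx
  have key : 1 ≤ s * (x.2 - b) ∧ s * x.2 ≤ s * h := by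
    rcases hs with rfl | rfl
    · rw [min_eq_left (by linarith)] at h2
      rw [max_eq_right (by linarith)] at h3
      constructor <;> linarith
    · rw [min_eq_right (by linarith)] at h2
      rw [max_eq_left (by linarith)] at h3
      constructor <;> linarith
  refine ⟨⟨by linarith [key.1], key.2, fun h' => ?_, fun _ => hx1⟩, key.1⟩
  have : s * (x.2 - b) = 1 := le_antisymm h' key.1
  rw [this, hx1]; ring

theorem OnStem.mem_Icc (hx : OnStem a b c h s x) {lo hi : ℝ} (ha : lo ≤ a ∧ a ≤ hi)
    (hc : lo ≤ c ∧ c ≤ hi) : lo ≤ x.1 ∧ x.1 ≤ hi := by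
  rcases le_total (s * (x.2 - b)) 1 with h1 | h1
  · have h0 := hx.base_le
    rw [hx.slanted h1]
    constructor <;> nlinarith
  · rw [hx.vertical h1]; exact hc

/-- At the height of the vertex, a stem contains nothing but the vertex. -/
theorem OnStem.eq_base (hx : OnStem a b c h s x) (h0 : x.2 = b) : x = (a, b) := by
  refine Prod.ext ?_ h0
  rw [hx.slanted (by rw [h0]; simp), h0]; simp

end Stem

/-! ### Column layouts -/

/-- The data of a drawing of `G` in which every vertex `u`, placed at `(X u, Y u)`, owns the columns
between `lo u` and `hi u`, and every edge leaves each of its ends by a stem in the columns of that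
end, the two stems being joined by a horizontal bar beyond all vertices. The stem of `uv` at `u` is
vertical in the column `col u v`; the bar of `uv` lies at height `far u v`, above the vertices if
`side u v = 1` and below them if `side u v = -1`. Around each vertex the rows from `yLo` to `yHi`
are kept free of bars. -/
structure ColumnLayout {V : Type*} (G : SimpleGraph V) where
  /-- The horizontal coordinate of a vertex. -/
  X : V → ℝ
  /-- The vertical coordinate of a vertex. -/
  Y : V → ℝ
  /-- The leftmost column of a vertex. -/
  lo : V → ℝ
  /-- The rightmost column of a vertex. -/
  hi : V → ℝ
  /-- The lowest row of a vertex. -/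
  yLo : V → ℝ
  /-- The highest row of a vertex. -/
  yHi : V → ℝ
  /-- The column of the stem of `uv` at `u`. -/
  col : V → V → ℝ
  /-- The height of the bar of `uv`. -/
  far : V → V → ℝ
  /-- The side of the bar of `uv`. -/
  side : V → V → ℝ
  lo_le : ∀ u, lo u + 1 ≤ X u
  le_hi : ∀ u, X u + 1 ≤ hi u
  yLo_le : ∀ u, yLo u + 1 ≤ Y u
  le_yHi : ∀ u, Y u + 1 ≤ yHi u
  sep : ∀ u w, u ≠ w → hi u < lo w ∨ hi w < lo u
  side_eq : ∀ u v, side u v = 1 ∨ side u v = -1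
  side_symm : ∀ u v, side v u = side u v
  far_symm : ∀ u v, far v u = far u v
  col_mem : ∀ u v, G.Adj u v → lo u ≤ col u v ∧ col u v ≤ hi u
  /-- Upward stems lean to the right and downward stems to the left. -/
  col_quadrant : ∀ u v, G.Adj u v → 0 ≤ side u v * (col u v - X u)
  col_inj : ∀ u v w, G.Adj u v → G.Adj u w → side u v = side u w → col u v = col u w → v = w
  far_beyond : ∀ u v, G.Adj u v → ∀ w y, yLo w ≤ y → y ≤ yHi w → 0 < side u v * (far u v - y)
  /-- A stem that reaches the height of another bar avoids it. -/
  nesting : ∀ u v u' v', G.Adj u v → G.Adj u' v' → s(u, v) ≠ s(u', v') → side u v = side u' v' →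
    side u v * far u' v' ≤ side u v * far u v → col u v ∉ Set.uIcc (col u' v') (col v' u')

namespace ColumnLayout

variable {V : Type*} {G : SimpleGraph V} (L : ColumnLayout G)

/-- The placement of the vertices. -/
def pos (u : V) : Plane := (L.X u, L.Y u)

/-- The four bends of the edge `uv`. -/
def bends (u v : V) : List Plane :=
  [(L.col u v, L.Y u + L.side u v), (L.col u v, L.far u v), (L.col v u, L.far u v),
    (L.col v u, L.Y v + L.side u v)]

/-- The stem of the edge `uv` at `u`. -/
def Stem (u v : V) (x : Plane) : Prop :=
  OnStem (L.X u) (L.Y u) (L.col u v) (L.far u v) (L.side u v) x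

/-- The bar of the edge `uv`. -/
def Bar (u v : V) (x : Plane) : Prop :=
  x.1 ∈ Set.uIcc (L.col u v) (L.col v u) ∧ x.2 = L.far u v

variable {L} {u v u' v' w : V} {x : Plane}

theorem one_lt_far (huv : G.Adj u v) (w : V) : 1 < L.side u v * (L.far u v - L.Y w) := by
  have h1 := L.yLo_le w
  have h2 := L.le_yHi w
  have h3 := L.far_beyond u v huv w (L.yLo w) le_rfl (by linarith)
  have h4 := L.far_beyond u v huv w (L.yHi w) (by linarith) le_rfl
  rcases L.side_eq u v with h | h <;> rw [h] at h3 h4 ⊢ <;> linarith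

theorem Stem.mem_Icc (huv : G.Adj u v) (hx : L.Stem u v x) : L.lo u ≤ x.1 ∧ x.1 ≤ L.hi u :=
  OnStem.mem_Icc hx ⟨by linarith [L.lo_le u], by linarith [L.le_hi u]⟩ (L.col_mem u v huv)

theorem eq_of_mem_columns {z : ℝ} (h : L.lo u ≤ z ∧ z ≤ L.hi u) (h' : L.lo w ≤ z ∧ z ≤ L.hi w) :
    u = w := by
  by_contra hne
  rcases L.sep u w hne with h1 | h1 <;> linarith [h.1, h.2, h'.1, h'.2]

theorem X_mem_columns (u : V) : L.lo u ≤ L.X u ∧ L.X u ≤ L.hi u :=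
  ⟨by linarith [L.lo_le u], by linarith [L.le_hi u]⟩

/-- The segments of the edge `uv`, with what the proofs use of each. -/
theorem segment_cases (huv : G.Adj u v) :
    (∀ x ∈ segment ℝ (L.pos u) (L.col u v, L.Y u + L.side u v),
      L.Stem u v x ∧ L.side u v * (x.2 - L.Y u) ≤ 1) ∧
    (∀ x ∈ segment ℝ (L.col u v, L.Y u + L.side u v) (L.col u v, L.far u v),
      L.Stem u v x ∧ 1 ≤ L.side u v * (x.2 - L.Y u)) ∧
    (∀ x ∈ segment ℝ (L.col u v, L.far u v) (L.col v u, L.far u v), L.Bar u v x) ∧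
    (∀ x ∈ segment ℝ (L.col v u, L.far u v) (L.col v u, L.Y v + L.side u v),
      L.Stem v u x ∧ 1 ≤ L.side u v * (x.2 - L.Y v)) ∧
    (∀ x ∈ segment ℝ (L.col v u, L.Y v + L.side u v) (L.pos v),
      L.Stem v u x ∧ L.side u v * (x.2 - L.Y v) ≤ 1) := by
  have h1 := (one_lt_far (L := L) huv u).le
  have h2 := (one_lt_far (L := L) huv v).le
  have hs := L.side_eq u v
  refine ⟨fun x hx => onStem_of_mem_slanted hs h1 hx, fun x hx => onStem_of_mem_vertical hs h1 hx,
    fun x hx => mem_segment_horizontal hx, fun x hx => ?_, fun x hx => ?_⟩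
  · rw [segment_symm] at hx
    have := onStem_of_mem_vertical (a := L.X v) hs h2 hx
    unfold Stem
    rwa [L.side_symm u v, L.far_symm u v]
  · rw [segment_symm] at hx
    have := onStem_of_mem_slanted hs h2 hx
    unfold Stem
    rwa [L.side_symm u v, L.far_symm u v]

theorem trace_cases (huv : G.Adj u v) (hx : x ∈ polyTrace (edgePolyline L.pos L.bends u v)) :
    L.Stem u v x ∨ L.Bar u v x ∨ L.Stem v u x := by
  obtain ⟨h1, h2, h3, h4, h5⟩ := segment_cases (L := L) huv
  simp only [edgePolyline, bends, List.cons_append, List.nil_append, polyTrace, Set.mem_union,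
    Set.mem_singleton_iff] at hx
  rcases hx with hx | hx | hx | hx | hx | hx
  · exact Or.inl (h1 x hx).1
  · exact Or.inl (h2 x hx).1
  · exact Or.inr (Or.inl (h3 x hx))
  · exact Or.inr (Or.inr (h4 x hx).1)
  · exact Or.inr (Or.inr (h5 x hx).1)
  · exact Or.inr (Or.inr (h5 x (hx ▸ right_mem_segment ℝ _ _)).1)

theorem not_stem_and_stem_swap (huv : G.Adj u v) (h : L.Stem u v x) (h' : L.Stem v u x) : False :=
  huv.ne (eq_of_mem_columns (h.mem_Icc huv) (h'.mem_Icc huv.symm))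

theorem isSimplePolyline (huv : G.Adj u v) :
    IsSimplePolyline (edgePolyline L.pos L.bends u v) := by
  obtain ⟨h1, h2, h3, h4, h5⟩ := segment_cases (L := L) huv
  have hs := L.side_eq u v
  have hs0 : L.side u v ≠ 0 := by rcases hs with h | h <;> rw [h] <;> norm_num
  have hu := one_lt_far (L := L) huv u
  have hv := one_lt_far (L := L) huv v
  have hcol : L.col u v ≠ L.col v u := fun h => huv.ne (eq_of_mem_columns (L.col_mem u v huv)
    (h ▸ L.col_mem v u huv.symm))
  have hend : ∀ y : ℝ, ∀ w, 1 ≤ L.side u v * (y - L.Y w) → L.side u v * (y - L.Y w) ≤ 1 →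
      y = L.Y w + L.side u v := by
    intro y w ha hb
    rcases hs with h | h <;> rw [h] at ha hb ⊢ <;> linarith
  have hfar : ∀ w, L.far u v ≠ L.Y w + L.side u v := by
    intro w h
    have := one_lt_far (L := L) huv w
    rw [h] at this
    rcases hs with h | h <;> rw [h] at this <;> linarith
  simp only [edgePolyline, bends, List.cons_append, List.nil_append, IsSimplePolyline, polyTrace,
    Set.mem_union, Set.mem_singleton_iff, and_true]
  have h6 : ∀ x, x = L.pos v → L.Stem v u x ∧ L.side u v * (x.2 - L.Y v) ≤ 1 :=
    fun x hx => h5 x (hx ▸ right_mem_segment ℝ _ _)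
  refine ⟨?_, ?_, ?_, ?_, ?_, ?_, ?_, ?_, ?_, ?_⟩
  · intro h
    exact hs0 (by simpa [pos] using congrArg Prod.snd h)
  · intro x hx hx'
    have hx := h1 x hx
    rcases hx' with hx' | hx' | hx' | hx' | hx'
    · have hx' := h2 x hx'
      exact Prod.ext (hx'.1.vertical hx'.2) (hend _ _ hx'.2 hx.2)
    · have hx' := (h3 x hx').2
      rw [hx'] at hx; linarith [hx.2]
    · exact (not_stem_and_stem_swap huv hx.1 (h4 x hx').1).elim
    · exact (not_stem_and_stem_swap huv hx.1 (h5 x hx').1).elim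
    · exact (not_stem_and_stem_swap huv hx.1 (h6 x hx').1).elim
  · intro h
    exact hfar u (by simpa using (congrArg Prod.snd h).symm)
  · intro x hx hx'
    have hx := h2 x hx
    rcases hx' with hx' | hx' | hx' | hx'
    · exact Prod.ext (hx.1.vertical hx.2) (h3 x hx').2
    · exact (not_stem_and_stem_swap huv hx.1 (h4 x hx').1).elim
    · exact (not_stem_and_stem_swap huv hx.1 (h5 x hx').1).elim
    · exact (not_stem_and_stem_swap huv hx.1 (h6 x hx').1).elim
  · intro h
    exact hcol (congrArg Prod.fst h)
  · intro x hx hx'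
    have hx := h3 x hx
    rcases hx' with hx' | hx' | hx'
    · have hx' := h4 x hx'
      exact Prod.ext (hx'.1.vertical (by rw [L.side_symm u v]; exact hx'.2)) hx.2
    · have hx' := (h5 x hx').2
      rw [hx.2] at hx'; linarith
    · have hx' := (h6 x hx').2
      rw [hx.2] at hx'; linarith
  · intro h
    exact hfar v (by simpa using congrArg Prod.snd h)
  · intro x hx hx'
    have hx := h4 x hx
    have hx' : L.Stem v u x ∧ L.side u v * (x.2 - L.Y v) ≤ 1 := by
      rcases hx' with hx' | hx'
      · exact h5 x hx'
      · exact h6 x hx'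
    exact Prod.ext (hx.1.vertical (by rw [L.side_symm u v]; exact hx.2)) (hend _ _ hx.2 hx'.2)
  · intro h
    exact hs0 (by simpa [pos] using congrArg Prod.snd h)
  · intro x _ hx'
    exact hx'

theorem eq_of_pos_mem_stem (huv : G.Adj u v) (h : L.Stem u v (L.pos w)) : w = u :=
  eq_of_mem_columns (X_mem_columns w) (h.mem_Icc huv)

theorem not_bar_pos (huv : G.Adj u v) : ¬ L.Bar u v (L.pos w) := by
  intro h
  have h1 := one_lt_far (L := L) huv w
  have h2 : L.Y w = L.far u v := h.2
  rw [h2] at h1; norm_num at h1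

/-- Two stems of distinct edges meet only in a common vertex. -/
theorem Stem.eq_pos (huv : G.Adj u v) (huv' : G.Adj u' v') (hne : s(u, v) ≠ s(u', v'))
    (h : L.Stem u v x) (h' : L.Stem u' v' x) : u = u' ∧ x = L.pos u := by
  have huu : u = u' := eq_of_mem_columns (h.mem_Icc huv) (h'.mem_Icc huv')
  subst huu
  refine ⟨rfl, ?_⟩
  have hvv : v ≠ v' := by rintro rfl; exact hne rfl
  apply OnStem.eq_base h
  have hb := h.base_le
  have hb' := h'.base_le
  by_cases hside : L.side u v = L.side u v'
  · have hcol : L.col u v ≠ L.col u v' := fun hc => hvv (L.col_inj u v v' huv huv' hside hc)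
    rcases lt_or_ge (L.side u v * (x.2 - L.Y u)) 1 with h1 | h1
    · have e1 := h.slanted h1.le
      have e2 := h'.slanted (by rw [← hside]; exact h1.le)
      rw [← hside, e1] at e2
      have e3 : L.side u v * (x.2 - L.Y u) * (L.col u v - L.col u v') = 0 := by linarith
      rcases mul_eq_zero.1 e3 with e4 | e4
      · rcases L.side_eq u v with hs | hs <;> rw [hs] at e4 <;> linarith
      · exact absurd (sub_eq_zero.1 e4) hcol
    · exact absurd ((h.vertical h1).symm.trans (h'.vertical (hside ▸ h1))) hcol
  · rcases L.side_eq u v with hs | hs <;> rcases L.side_eq u v' with hs' | hs' <;>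
      rw [hs] at hb hside <;> rw [hs'] at hb' hside <;> first | exact absurd rfl hside | linarith

theorem not_stem_and_bar (huv : G.Adj u v) (huv' : G.Adj u' v') (hne : s(u, v) ≠ s(u', v'))
    (h : L.Stem u v x) (h' : L.Bar u' v' x) : False := by
  have h1 := one_lt_far (L := L) huv' u
  have hb := h.base_le
  have hf := h.le_far
  rw [h'.2] at hb hf
  have hside : L.side u v = L.side u' v' := by
    rcases L.side_eq u v with hs | hs <;> rcases L.side_eq u' v' with hs' | hs' <;>
      rw [hs] at hb ⊢ <;> rw [hs'] at h1 ⊢ <;> linarith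
  refine L.nesting u v u' v' huv huv' hne hside hf ?_
  rw [← h.vertical (by rw [h'.2, hside]; exact h1.le)]
  exact h'.1

theorem not_bar_and_bar (huv : G.Adj u v) (huv' : G.Adj u' v') (hne : s(u, v) ≠ s(u', v'))
    (h : L.Bar u v x) (h' : L.Bar u' v' x) : False := by
  have hfar : L.far u v = L.far u' v' := h.2.symm.trans h'.2
  have hside : L.side u v = L.side u' v' := by
    have h1 := one_lt_far (L := L) huv u
    have h2 := one_lt_far (L := L) huv' u
    rw [← hfar] at h2
    rcases L.side_eq u v with hs | hs <;> rcases L.side_eq u' v' with hs' | hs' <;>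
      rw [hs] at h1 ⊢ <;> rw [hs'] at h2 ⊢ <;> linarith
  have n1 := L.nesting u v u' v' huv huv' hne hside (by rw [hfar])
  have n2 := L.nesting v u u' v' huv.symm huv' (by rwa [Sym2.eq_swap])
    (by rw [L.side_symm u v, hside]) (by rw [L.far_symm u v, hfar])
  have n3 := L.nesting u' v' u v huv' huv hne.symm hside.symm (by rw [hfar])
  have n4 := L.nesting v' u' u v huv'.symm huv (by rw [Sym2.eq_swap]; exact hne.symm)
    (by rw [L.side_symm u' v', hside]) (by rw [L.far_symm u' v', hfar])
  have e1 := h.1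
  have e2 := h'.1
  simp only [Set.mem_uIcc, not_or, not_and_or, not_le] at n1 n2 n3 n4 e1 e2
  grind

theorem isPlanarPolylineDrawing (L : ColumnLayout G) :
    IsPlanarPolylineDrawing G L.pos L.bends where
  pos_injective u w h := by
    have : L.X u = L.X w := congrArg Prod.fst h
    exact eq_of_mem_columns (X_mem_columns (L := L) u) (this ▸ X_mem_columns w)
  bends_symm u v _ := by simp [bends, L.far_symm u v, L.side_symm u v]
  simple u v huv := isSimplePolyline huv
  vertex_on_edge u v w huv hw := by
    rcases trace_cases huv hw with h | h | h
    · exact Or.inl (eq_of_pos_mem_stem huv h)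
    · exact (not_bar_pos huv h).elim
    · exact Or.inr (eq_of_pos_mem_stem huv.symm h)
  edges_disjoint u v u' v' huv huv' hne x hx hx' := by
    have hne1 : s(v, u) ≠ s(u', v') := by rwa [Sym2.eq_swap]
    have hne2 : s(u, v) ≠ s(v', u') := by rwa [Sym2.eq_swap (a := v')]
    have hne3 : s(v, u) ≠ s(v', u') := by rwa [Sym2.eq_swap, Sym2.eq_swap (a := v')]
    rcases trace_cases huv hx with h | h | h <;> rcases trace_cases huv' hx' with h' | h' | h'
    · obtain ⟨rfl, rfl⟩ := h.eq_pos huv huv' hne h'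
      exact ⟨u, by simp, by simp, rfl⟩
    · exact (not_stem_and_bar huv huv' hne h h').elim
    · obtain ⟨rfl, rfl⟩ := h.eq_pos huv huv'.symm hne2 h'
      exact ⟨u, by simp, by simp, rfl⟩
    · exact (not_stem_and_bar huv' huv hne.symm h' h).elim
    · exact (not_bar_and_bar huv huv' hne h h').elim
    · exact (not_stem_and_bar huv'.symm huv hne2.symm h' h).elim
    · obtain ⟨rfl, rfl⟩ := h.eq_pos huv.symm huv' hne1 h'
      exact ⟨v, by simp, by simp, rfl⟩
    · exact (not_stem_and_bar huv.symm huv' hne1 h h').elim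
    · obtain ⟨rfl, rfl⟩ := h.eq_pos huv.symm huv'.symm hne3 h'
      exact ⟨v, by simp, by simp, rfl⟩

end ColumnLayout

/-! ### Combining a column layout with a rotated one -/

theorem OnStem.quadrant {a b c h s : ℝ} {x : Plane} (hx : OnStem a b c h s x)
    (hc : 0 ≤ s * (c - a)) : 0 ≤ s * (x.1 - a) := by
  rcases le_total (s * (x.2 - b)) 1 with h1 | h1
  · have : s * (x.1 - a) = s * (x.2 - b) * (s * (c - a)) := by rw [hx.slanted h1]; ring
    rw [this]
    exact mul_nonneg hx.base_le hc
  · rwa [hx.vertical h1]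

theorem mem_polySegments_quarterTurn (C : ℝ) {L : List Plane} {s : Plane × Plane}
    (h : s ∈ polySegments L) :
    (quarterTurn C s.1, quarterTurn C s.2) ∈ polySegments (L.map (quarterTurn C)) := by
  unfold polySegments at h ⊢
  rw [← List.map_tail, List.zip_map]
  exact List.mem_map.2 ⟨s, h, rfl⟩

theorem mem_openSegment_quarterTurn (C : ℝ) {p q x : Plane}
    (h : quarterTurnInv C x ∈ openSegment ℝ p q) :
    x ∈ openSegment ℝ (quarterTurn C p) (quarterTurn C q) := by
  simp only [mem_openSegment_coord, quarterTurn, quarterTurnInv] at h ⊢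
  obtain ⟨t, h0, h1, h2, h3⟩ := h
  exact ⟨t, h0, h1, by linarith, by linarith⟩

namespace ColumnLayout

variable {V : Type*} {G₁ G₂ : SimpleGraph V}

/-- The interior of the vertical part of a stem is the interior of a segment of the edge. -/
theorem exists_vertical_segment {G : SimpleGraph V} {L : ColumnLayout G} {u v a b : V} {x : Plane}
    (huv : G.Adj u v) (hab : a = u ∧ b = v ∨ a = v ∧ b = u) (hx : L.Stem a b x)
    (h1 : 1 < L.side a b * (x.2 - L.Y a)) (h2 : 0 < L.side a b * (L.far a b - x.2)) :
    ∃ s ∈ polySegments (edgePolyline L.pos L.bends u v),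
      x ∈ openSegment ℝ s.1 s.2 ∧ s.1.1 = s.2.1 := by
  have hx1 := hx.vertical h1.le
  have hopen : x ∈ openSegment ℝ (L.col a b, L.Y a + L.side a b) (L.col a b, L.far a b) := by
    refine mem_openSegment_vertical hx1 ?_
    rcases L.side_eq a b with hs | hs <;> rw [hs] at h1 h2 ⊢
    · left; constructor <;> linarith
    · right; constructor <;> linarith
  rcases hab with ⟨rfl, rfl⟩ | ⟨rfl, rfl⟩
  · exact ⟨((L.col a b, L.Y a + L.side a b), (L.col a b, L.far a b)),
      by simp [polySegments, edgePolyline, bends], hopen, rfl⟩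
  · rw [openSegment_symm, L.far_symm b a, L.side_symm b a] at hopen
    exact ⟨((L.col a b, L.far b a), (L.col a b, L.Y a + L.side b a)),
      by simp [polySegments, edgePolyline, bends], hopen, rfl⟩

/-- Two column layouts fit together if the second one, turned by a quarter, has the same vertices
as the first, and each keeps its bars out of the columns, respectively rows, of the other. -/
structure Fits (L₁ : ColumnLayout G₁) (L₂ : ColumnLayout G₂) (C : ℝ) : Prop where
  Y_left : ∀ u, L₁.Y u = C - L₂.X u
  Y_right : ∀ u, L₂.Y u = L₁.X u
  yLo_left : ∀ u, L₁.yLo u = C - L₂.hi u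
  yHi_left : ∀ u, L₁.yHi u = C - L₂.lo u
  yLo_right : ∀ u, L₂.yLo u = L₁.lo u
  yHi_right : ∀ u, L₂.yHi u = L₁.hi u

variable {L₁ : ColumnLayout G₁} {L₂ : ColumnLayout G₂} {C : ℝ} {u v u' v' : V} {x : Plane}

theorem Fits.pos_eq (h : Fits L₁ L₂ C) (u : V) : quarterTurn C (L₂.pos u) = L₁.pos u := by
  simp [quarterTurn, pos, h.Y_left, h.Y_right]

/-- The stems at one vertex lie in different quadrants, and so meet only in the vertex. -/
theorem Fits.stem_same (h : Fits L₁ L₂ C) (huv : G₁.Adj u v) (huv' : G₂.Adj u v')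
    (hx : L₁.Stem u v x) (hx' : L₂.Stem u v' (quarterTurnInv C x)) : x = L₁.pos u := by
  have a1 := hx.base_le
  have a2 := hx.quadrant (L₁.col_quadrant u v huv)
  have b1 := hx'.base_le
  have b2 := hx'.quadrant (L₂.col_quadrant u v' huv')
  simp only [quarterTurnInv, h.Y_right] at b1 b2
  have hY := h.Y_left u
  by_cases hs : L₁.side u v = L₂.side u v'
  · apply OnStem.eq_base hx
    rw [← hs] at b1 b2
    rcases L₁.side_eq u v with e | e <;> rw [e] at a1 a2 b1 b2 <;> linarith
  · have : quarterTurnInv C x = L₂.pos u := by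
      apply OnStem.eq_base hx'
      simp only [quarterTurnInv, h.Y_right]
      rcases L₁.side_eq u v with e | e <;> rcases L₂.side_eq u v' with e' | e' <;>
        rw [e] at a1 a2 hs <;> rw [e'] at b1 b2 hs <;> first | exact absurd rfl hs | linarith
    rw [← h.pos_eq, ← this, quarterTurn_inv]

theorem Fits.row_mem (h : Fits L₁ L₂ C) (huv' : G₂.Adj u' v')
    (hx' : L₂.Stem u' v' (quarterTurnInv C x)) : L₁.yLo u' ≤ x.2 ∧ x.2 ≤ L₁.yHi u' := by
  have := hx'.mem_Icc huv'
  simp only [quarterTurnInv] at this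
  rw [h.yLo_left, h.yHi_left]
  constructor <;> linarith [this.1, this.2]

theorem Fits.column_mem (h : Fits L₁ L₂ C) (huv : G₁.Adj u v) (hx : L₁.Stem u v x) :
    L₂.yLo u ≤ (quarterTurnInv C x).2 ∧ (quarterTurnInv C x).2 ≤ L₂.yHi u := by
  have := hx.mem_Icc huv
  rwa [h.yLo_right, h.yHi_right]

/-- Stems of the two layouts at distinct vertices meet only where both are straight, because the
slanted part of a stem stays within the rows and columns of its vertex. -/
theorem Fits.stem_ne (h : Fits L₁ L₂ C) (huv : G₁.Adj u v) (huv' : G₂.Adj u' v') (hne : u ≠ u')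
    (hx : L₁.Stem u v x) (hx' : L₂.Stem u' v' (quarterTurnInv C x)) :
    (1 < L₁.side u v * (x.2 - L₁.Y u) ∧ 0 < L₁.side u v * (L₁.far u v - x.2)) ∧
    (1 < L₂.side u' v' * ((quarterTurnInv C x).2 - L₂.Y u') ∧
      0 < L₂.side u' v' * (L₂.far u' v' - (quarterTurnInv C x).2)) := by
  have hr := h.row_mem huv' hx'
  have hc := h.column_mem huv hx
  refine ⟨⟨?_, L₁.far_beyond u v huv u' _ hr.1 hr.2⟩, ?_, L₂.far_beyond u' v' huv' u _ hc.1 hc.2⟩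
  · have a1 := hx.base_le
    have a2 := L₂.sep u u' hne
    have a3 := L₂.lo_le u
    have a4 := L₂.le_hi u
    rw [h.yLo_left, h.yHi_left] at hr
    rw [h.Y_left] at a1 ⊢
    rcases L₁.side_eq u v with e | e <;> rw [e] at a1 ⊢ <;> rcases a2 with a2 | a2 <;>
      linarith [hr.1, hr.2]
  · have a1 := hx'.base_le
    have a2 := L₁.sep u u' hne
    have a3 := L₁.lo_le u'
    have a4 := L₁.le_hi u'
    rw [h.yLo_right, h.yHi_right] at hc
    rw [h.Y_right] at a1 ⊢
    rcases L₂.side_eq u' v' with e | e <;> rw [e] at a1 ⊢ <;> rcases a2 with a2 | a2 <;>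
      linarith [hc.1, hc.2]

theorem Fits.not_stem_bar (h : Fits L₁ L₂ C) (huv : G₁.Adj u v) (huv' : G₂.Adj u' v')
    (hx : L₁.Stem u v x) (hx' : L₂.Bar u' v' (quarterTurnInv C x)) : False := by
  have hc := h.column_mem huv hx
  have := L₂.far_beyond u' v' huv' u _ hc.1 hc.2
  rw [hx'.2] at this
  simp at this

theorem Fits.not_bar_stem (h : Fits L₁ L₂ C) (huv : G₁.Adj u v) (huv' : G₂.Adj u' v')
    (hx : L₁.Bar u v x) (hx' : L₂.Stem u' v' (quarterTurnInv C x)) : False := by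
  have hr := h.row_mem huv' hx'
  have := L₁.far_beyond u v huv u' _ hr.1 hr.2
  rw [hx.2] at this
  simp at this

theorem Fits.not_bar_bar (h : Fits L₁ L₂ C) (huv : G₁.Adj u v) (huv' : G₂.Adj u' v')
    (hx : L₁.Bar u v x) (hx' : L₂.Bar u' v' (quarterTurnInv C x)) : False := by
  have c1 := L₁.col_mem u v huv
  have c2 := L₁.col_mem v u huv.symm
  rw [← h.yLo_right, ← h.yHi_right] at c1 c2
  have f1 := L₂.far_beyond u' v' huv' u _ c1.1 c1.2
  have f2 := L₂.far_beyond u' v' huv' v _ c2.1 c2.2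
  have e : x.1 = L₂.far u' v' := hx'.2
  have m := hx.1
  rw [e, Set.mem_uIcc] at m
  rcases L₂.side_eq u' v' with e | e <;> rw [e] at f1 f2 <;> rcases m with m | m <;>
    linarith [m.1, m.2]

theorem Fits.right_angle (h : Fits L₁ L₂ C) (huv : G₁.Adj u v) (huv' : G₂.Adj u' v')
    (hx : x ∈ polyTrace (edgePolyline L₁.pos L₁.bends u v))
    (hx' : quarterTurnInv C x ∈ polyTrace (edgePolyline L₂.pos L₂.bends u' v')) :
    (∃ w, w ∈ s(u, v) ∧ w ∈ s(u', v') ∧ x = L₁.pos w) ∨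
      IsRightAngleCrossing (edgePolyline L₁.pos L₁.bends u v)
        ((edgePolyline L₂.pos L₂.bends u' v').map (quarterTurn C)) x := by
  have key : ∀ a b a' b', (a = u ∧ b = v ∨ a = v ∧ b = u) → (a' = u' ∧ b' = v' ∨ a' = v' ∧ b' = u') →
      L₁.Stem a b x → L₂.Stem a' b' (quarterTurnInv C x) →
      (∃ w, w ∈ s(u, v) ∧ w ∈ s(u', v') ∧ x = L₁.pos w) ∨
      IsRightAngleCrossing (edgePolyline L₁.pos L₁.bends u v)
        ((edgePolyline L₂.pos L₂.bends u' v').map (quarterTurn C)) x := by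
    intro a b a' b' hab hab' hs hs'
    have hadj : G₁.Adj a b := by rcases hab with ⟨rfl, rfl⟩ | ⟨rfl, rfl⟩; exacts [huv, huv.symm]
    have hadj' : G₂.Adj a' b' := by
      rcases hab' with ⟨rfl, rfl⟩ | ⟨rfl, rfl⟩; exacts [huv', huv'.symm]
    by_cases haa : a = a'
    · subst haa
      refine Or.inl ⟨a, ?_, ?_, h.stem_same hadj hadj' hs hs'⟩
      · rcases hab with ⟨rfl, -⟩ | ⟨rfl, -⟩ <;> simp
      · rcases hab' with ⟨rfl, -⟩ | ⟨rfl, -⟩ <;> simp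
    · right
      obtain ⟨⟨h1, h2⟩, h3, h4⟩ := h.stem_ne hadj hadj' haa hs hs'
      obtain ⟨s, hs1, hs2, hs3⟩ := exists_vertical_segment huv hab hs h1 h2
      obtain ⟨t, ht1, ht2, ht3⟩ := exists_vertical_segment huv' hab' hs' h3 h4
      refine ⟨s, hs1, _, mem_polySegments_quarterTurn C ht1, hs2,
        mem_openSegment_quarterTurn C ht2, ?_⟩
      simp [SegPerp, quarterTurn, hs3, ht3]
  rcases trace_cases huv hx with hs | hs | hs <;> rcases trace_cases huv' hx' with hs' | hs' | hs'
  · exact key _ _ _ _ (by simp) (by simp) hs hs'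
  · exact (h.not_stem_bar huv huv' hs hs').elim
  · exact key _ _ _ _ (by simp) (by simp) hs hs'
  · exact (h.not_bar_stem huv huv' hs hs').elim
  · exact (h.not_bar_bar huv huv' hs hs').elim
  · exact (h.not_bar_stem huv huv'.symm hs hs').elim
  · exact key _ _ _ _ (by simp) (by simp) hs hs'
  · exact (h.not_stem_bar huv.symm huv' hs hs').elim
  · exact key _ _ _ _ (by simp) (by simp) hs hs'

/-- The simultaneous drawing made of two column layouts that fit together. -/
def Fits.drawing (h : Fits L₁ L₂ C) : RacSimDrawing G₁ G₂ where
  pos := L₁.pos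
  bends₁ := L₁.bends
  bends₂ := fun u v => (L₂.bends u v).map (quarterTurn C)
  planar₁ := L₁.isPlanarPolylineDrawing
  planar₂ := by
    have := L₂.isPlanarPolylineDrawing.quarterTurn C
    simpa only [h.pos_eq] using this
  no_overlap := by
    refine no_overlap_of_right_angle fun u v u' v' huv huv' x hx hx' => ?_
    rw [show L₁.pos = fun w => quarterTurn C (L₂.pos w) from funext fun w => (h.pos_eq w).symm]
      at hx'
    rw [edgePolyline_quarterTurn, mem_polyTrace_quarterTurn] at hx'
    have := h.right_angle huv huv' hx hx'
    rw [← edgePolyline_quarterTurn] at this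
    simpa only [h.pos_eq] using this
  right_angle := by
    intro u v u' v' huv huv' x hx hx'
    rw [show L₁.pos = fun w => quarterTurn C (L₂.pos w) from funext fun w => (h.pos_eq w).symm]
      at hx'
    rw [edgePolyline_quarterTurn, mem_polyTrace_quarterTurn] at hx'
    have := h.right_angle huv huv' hx hx'
    rw [← edgePolyline_quarterTurn] at this
    simpa only [h.pos_eq] using this

end ColumnLayout

/-! ### Column layouts from two-page drawings along a spine -/

/-- No two edges of a graph on an ordered set have alternating ends. -/
def Noncrossing {k : ℕ} (T : SimpleGraph (Fin k)) : Prop :=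
  ∀ a b c d, T.Adj a b → T.Adj c d → a < c → c < b → b < d → False

/-- The degree of a vertex, without decidability assumptions. -/
noncomputable def deg {k : ℕ} (T : SimpleGraph (Fin k)) (i : Fin k) : ℕ :=
  (T.neighborSet i).ncard

/-- The cyclic distance `i - w` modulo `k`, from `1` to `k`. Around `i`, it orders the other
vertices as their stems have to be ordered from left to right: those before `i` by increasing
distance, then those after `i` by decreasing distance. -/
def cyclicKey {k : ℕ} (i w : Fin k) : ℕ := if w < i then i - w else i + k - w

theorem cyclicKey_injective {k : ℕ} (i : Fin k) : Function.Injective (cyclicKey i) := by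
  intro v w h
  have hv := v.2
  have hw := w.2
  have hi := i.2
  unfold cyclicKey at h
  simp only [Fin.lt_def] at h
  ext
  split_ifs at h <;> omega

/-- The number of neighbours of `i` that precede `j` in the order by `cyclicKey i`. -/
noncomputable def rankBefore {k : ℕ} (T : SimpleGraph (Fin k)) (i j : Fin k) : ℕ :=
  {w | T.Adj i w ∧ cyclicKey i w < cyclicKey i j}.ncard

/-- The number of neighbours of `i` that follow `j` in the order by `cyclicKey i`. -/
noncomputable def rankAfter {k : ℕ} (T : SimpleGraph (Fin k)) (i j : Fin k) : ℕ :=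
  {w | T.Adj i w ∧ cyclicKey i j < cyclicKey i w}.ncard

section Rank

variable {k : ℕ} {T : SimpleGraph (Fin k)} {i j j' : Fin k}

theorem rankBefore_lt_deg (h : T.Adj i j) : rankBefore T i j < deg T i :=
  Set.ncard_lt_ncard ⟨fun _ hw => hw.1, fun hs => lt_irrefl _ (hs h).2⟩ (Set.toFinite _)

theorem rankAfter_lt_deg (h : T.Adj i j) : rankAfter T i j < deg T i :=
  Set.ncard_lt_ncard ⟨fun _ hw => hw.1, fun hs => lt_irrefl _ (hs h).2⟩ (Set.toFinite _)

theorem rankBefore_lt (h : T.Adj i j) (hj : cyclicKey i j < cyclicKey i j') :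
    rankBefore T i j < rankBefore T i j' :=
  Set.ncard_lt_ncard ⟨fun _ hw => ⟨hw.1, hw.2.trans hj⟩, fun hs => lt_irrefl _ (hs ⟨h, hj⟩).2⟩
    (Set.toFinite _)

theorem rankAfter_lt (h : T.Adj i j') (hj : cyclicKey i j < cyclicKey i j') :
    rankAfter T i j' < rankAfter T i j :=
  Set.ncard_lt_ncard ⟨fun _ hw => ⟨hw.1, hj.trans hw.2⟩, fun hs => lt_irrefl _ (hs ⟨h, hj⟩).2⟩
    (Set.toFinite _)

end Rank

/-- The distance of two vertices along the spine. -/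
def spineLength {k : ℕ} (i j : Fin k) : ℤ := |(j : ℤ) - i|

theorem spineLength_comm {k : ℕ} (i j : Fin k) : spineLength i j = spineLength j i :=
  abs_sub_comm _ _

/-- If the stems of a noncrossing graph are ordered by `cyclicKey` around every vertex, then the
stem of an edge avoids the columns under every edge that is not longer. -/
theorem column_not_mem_uIcc {k : ℕ} {T : SimpleGraph (Fin k)} (hT : Noncrossing T)
    {lo hi : Fin k → ℤ} {c : Fin k → Fin k → ℤ} (hsep : ∀ i j, i < j → hi i < lo j)
    (hmem : ∀ i j, T.Adj i j → lo i ≤ c i j ∧ c i j ≤ hi i)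
    (hmono : ∀ i j j', T.Adj i j → T.Adj i j' → cyclicKey i j < cyclicKey i j' → c i j < c i j')
    {i j i' j' : Fin k} (h : T.Adj i j) (h' : T.Adj i' j') (hne : s(i, j) ≠ s(i', j'))
    (hlen : spineLength i' j' ≤ spineLength i j) : c i j ∉ Set.uIcc (c i' j') (c j' i') := by
  wlog hlt : i' < j' generalizing i' j'
  · rw [Set.uIcc_comm]
    refine this h'.symm (by rwa [Sym2.eq_swap (a := j')]) (by rwa [spineLength_comm]) ?_
    exact lt_of_le_of_ne (not_lt.1 hlt) h'.ne.symm
  have m := hmem i j h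
  have m1 := hmem i' j' h'
  have m2 := hmem j' i' h'.symm
  have hs := hsep i' j' hlt
  rw [Set.uIcc_of_le (by linarith), Set.mem_Icc]
  rintro ⟨c1, c2⟩
  have hij := h.ne
  have hj := j.2
  have hj' := j'.2
  rw [spineLength, spineLength, abs_of_pos (by simp only [Fin.lt_def] at hlt; omega : (0 : ℤ) < j' - i')] at hlen
  have hi1 : i' ≤ i := by
    by_contra hc
    have := hsep i i' (not_le.1 hc)
    linarith
  have hi2 : i ≤ j' := by
    by_contra hc
    have := hsep j' i (not_le.1 hc)
    linarith
  rcases eq_or_lt_of_le hi1 with rfl | hi1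
  · have hjj : j ≠ j' := by rintro rfl; exact hne rfl
    have : cyclicKey i' j < cyclicKey i' j' := by
      unfold cyclicKey
      simp only [Fin.lt_def] at hlt ⊢
      rcases abs_cases ((j : ℤ) - i') with ⟨e, _⟩ | ⟨e, _⟩ <;> split_ifs <;> omega
    have := hmono _ _ _ h h' this
    linarith
  rcases eq_or_lt_of_le hi2 with rfl | hi2
  · have hjj : j ≠ i' := by rintro rfl; exact hne Sym2.eq_swap
    have : cyclicKey i i' < cyclicKey i j := by
      unfold cyclicKey
      simp only [Fin.lt_def] at hlt ⊢
      rcases abs_cases ((j : ℤ) - i) with ⟨e, _⟩ | ⟨e, _⟩ <;> split_ifs <;> omega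
    have := hmono _ _ _ h'.symm h this
    linarith
  · have hj1 : ¬ j' < j := fun hc => hT i' j' i j h' h hi1 hi2 hc
    have hj2 : ¬ j < i' := fun hc => hT j i i' j' h.symm h' hc hi1 hi2
    simp only [Fin.lt_def] at *
    rcases abs_cases ((j : ℤ) - i) with ⟨e, _⟩ | ⟨e, _⟩ <;> omega

/-- A drawing of `G` along a spine, with the edges of `up` drawn above and those of `down` drawn
below it. The edges of `up` have length at most `upRows`, and those of `down` have lengths from
`skip + 1` to `skip + downRows`; the bar of an edge is put on a row given by its length. -/
structure SpineDrawing {V : Type*} (G : SimpleGraph V) (k : ℕ) where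
  /-- The order of the vertices along the spine. -/
  spine : V ≃ Fin k
  /-- The upper page. -/
  up : SimpleGraph (Fin k)
  /-- The lower page. -/
  down : SimpleGraph (Fin k)
  /-- The number of rows used by the bars of the upper page. -/
  upRows : ℕ
  /-- The number of rows used by the bars of the lower page. -/
  downRows : ℕ
  /-- A length below those of the edges on the lower page. -/
  skip : ℕ
  up_noncrossing : Noncrossing up
  down_noncrossing : Noncrossing down
  up_or_down : ∀ u v, G.Adj u v → up.Adj (spine u) (spine v) ∨ down.Adj (spine u) (spine v)
  up_length : ∀ i j, up.Adj i j → spineLength i j ≤ upRows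
  down_length : ∀ i j, down.Adj i j → skip < spineLength i j ∧ spineLength i j ≤ skip + downRows

namespace SpineDrawing

variable {V : Type*} {G : SimpleGraph V} {k : ℕ} (P : SpineDrawing G k)

/-- The number of columns to the right of a vertex that belong to it. -/
noncomputable def right (i : Fin k) : ℕ := max 1 (deg P.up i - 1)

/-- The number of columns to the left of a vertex that belong to it. -/
noncomputable def left (i : Fin k) : ℕ := max 1 (deg P.down i - 1)

/-- The number of columns that belong to a vertex. -/
noncomputable def cols (i : Fin k) : ℕ := 1 + P.left i + P.right i

/-- The number of columns that belong to the vertices. -/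
noncomputable def width : ℕ := ∑ i, P.cols i

/-- The leftmost column of a vertex, if the columns in use begin after the column `a`. -/
noncomputable def low (a : ℤ) (i : Fin k) : ℤ := a + 1 + ∑ j with j < i, (P.cols j : ℤ)

/-- The column of a vertex. -/
noncomputable def center (a : ℤ) (i : Fin k) : ℤ := P.low a i + P.left i

/-- The rightmost column of a vertex. -/
noncomputable def high (a : ℤ) (i : Fin k) : ℤ := P.center a i + P.right i

open Classical in
/-- The column of the stem of the edge `ij` at `i`. -/
noncomputable def column (a : ℤ) (i j : Fin k) : ℤ :=
  if P.up.Adj i j then P.center a i + rankBefore P.up i j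
  else P.center a i - rankAfter P.down i j

open Classical in
/-- The row of the bar of the edge `ij`, if the rows from `downRows + 1` to `downRows + m` are
reserved for the vertices. -/
noncomputable def row (m : ℤ) (i j : Fin k) : ℤ :=
  if P.up.Adj i j then P.downRows + m + spineLength i j
  else P.downRows + 1 - (spineLength i j - P.skip)

open Classical in
/-- The side of the edge `ij`: `1` above and `-1` below the spine. -/
noncomputable def sign (i j : Fin k) : ℤ := if P.up.Adj i j then 1 else -1

theorem high_eq (a : ℤ) (i : Fin k) :
    P.high a i = a + ∑ j with j ≤ i, (P.cols j : ℤ) := by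
  have : (Finset.univ.filter (fun j : Fin k => j ≤ i)) =
      insert i (Finset.univ.filter (fun j => j < i)) := by
    ext j; simp [le_iff_eq_or_lt]
  rw [this, Finset.sum_insert (by simp), high, center, low, cols]
  push_cast; ring

theorem high_lt_low (a : ℤ) {i j : Fin k} (h : i < j) : P.high a i < P.low a j := by
  rw [high_eq, low]
  have : ∑ l with l ≤ i, (P.cols l : ℤ) ≤ ∑ l with l < j, (P.cols l : ℤ) :=
    Finset.sum_le_sum_of_subset_of_nonneg
      (fun l hl => by simp at hl ⊢; exact lt_of_le_of_lt hl h) (fun _ _ _ => by positivity)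
  linarith

theorem le_low (a : ℤ) (i : Fin k) : a + 1 ≤ P.low a i := by
  unfold low
  have : 0 ≤ ∑ j with j < i, (P.cols j : ℤ) := Finset.sum_nonneg fun _ _ => by positivity
  linarith

theorem high_le (a : ℤ) (i : Fin k) : P.high a i ≤ a + P.width := by
  rw [high_eq, width]
  push_cast
  have : ∑ l with l ≤ i, (P.cols l : ℤ) ≤ ∑ l, (P.cols l : ℤ) :=
    Finset.sum_le_sum_of_subset_of_nonneg (Finset.subset_univ _) (fun _ _ _ => by positivity)
  linarith

theorem low_lt_center (a : ℤ) (i : Fin k) : P.low a i + 1 ≤ P.center a i := by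
  unfold center left; omega

theorem center_lt_high (a : ℤ) (i : Fin k) : P.center a i + 1 ≤ P.high a i := by
  unfold high right; omega

variable {P} {i j i' j' : Fin k}

theorem column_up (a : ℤ) (h : P.up.Adj i j) :
    P.column a i j = P.center a i + rankBefore P.up i j := if_pos h

theorem column_down (a : ℤ) (h : ¬ P.up.Adj i j) :
    P.column a i j = P.center a i - rankAfter P.down i j := if_neg h

theorem rankBefore_le_right (h : P.up.Adj i j) : rankBefore P.up i j ≤ P.right i := by
  have := rankBefore_lt_deg h
  unfold right; omega

theorem rankAfter_le_left (h : P.down.Adj i j) : rankAfter P.down i j ≤ P.left i := by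
  have := rankAfter_lt_deg h
  unfold left; omega

theorem column_mem (a : ℤ) (h : P.up.Adj i j ∨ P.down.Adj i j) :
    P.low a i ≤ P.column a i j ∧ P.column a i j ≤ P.high a i := by
  have h1 := P.low_lt_center a i
  have h2 := P.center_lt_high a i
  by_cases hu : P.up.Adj i j
  · rw [column_up a hu]
    have := rankBefore_le_right hu
    unfold high
    omega
  · rw [column_down a hu]
    have := rankAfter_le_left (h.resolve_left hu)
    unfold high center
    omega

theorem up_columns (a : ℤ) (h : P.up.Adj i j) (h' : P.up.Adj i' j') (hne : s(i, j) ≠ s(i', j'))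
    (hlen : spineLength i' j' ≤ spineLength i j) :
    P.column a i j ∉ Set.uIcc (P.column a i' j') (P.column a j' i') :=
  column_not_mem_uIcc P.up_noncrossing (fun _ _ => P.high_lt_low a)
    (fun i j h => column_mem a (Or.inl h))
    (fun i j j' h h' hk => by
      rw [column_up a h, column_up a h']
      have := rankBefore_lt h hk
      omega) h h' hne hlen

theorem down_columns (a : ℤ) (h : P.down.Adj i j) (h' : P.down.Adj i' j')
    (hu : ¬ P.up.Adj i j) (hu' : ¬ P.up.Adj i' j') (hne : s(i, j) ≠ s(i', j'))
    (hlen : spineLength i' j' ≤ spineLength i j) :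
    P.column a i j ∉ Set.uIcc (P.column a i' j') (P.column a j' i') := by
  rw [column_down a hu, column_down a hu', column_down a (fun h => hu' h.symm)]
  refine column_not_mem_uIcc (lo := P.low a) (hi := P.high a)
    (c := fun i j => P.center a i - rankAfter P.down i j) P.down_noncrossing
    (fun _ _ => P.high_lt_low a) (fun i j h => ?_) (fun i j j' h h' hk => ?_) h h' hne hlen
  · have h1 := P.center_lt_high a i
    have := rankAfter_le_left h
    unfold center at *
    omega
  · have := rankAfter_lt h' hk
    omega

theorem column_inj (a : ℤ) (h : P.up.Adj i j ∨ P.down.Adj i j)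
    (h' : P.up.Adj i j' ∨ P.down.Adj i j') (hs : P.sign i j = P.sign i j')
    (hc : P.column a i j = P.column a i j') : j = j' := by
  by_contra hne
  rcases lt_or_gt_of_ne (fun e => hne (cyclicKey_injective i e)) with hk | hk <;>
    by_cases hu : P.up.Adj i j <;> by_cases hu' : P.up.Adj i j' <;>
    simp only [sign, hu, hu', if_true, if_false] at hs <;> try omega
  · rw [column_up a hu, column_up a hu'] at hc
    have := rankBefore_lt hu hk; omega
  · rw [column_down a hu, column_down a hu'] at hc
    have := rankAfter_lt (h'.resolve_left hu') hk; omega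
  · rw [column_up a hu, column_up a hu'] at hc
    have := rankBefore_lt hu' hk; omega
  · rw [column_down a hu, column_down a hu'] at hc
    have := rankAfter_lt (h.resolve_left hu) hk; omega

theorem sign_symm : P.sign j i = P.sign i j := by
  by_cases h : P.up.Adj i j
  · simp [sign, h, h.symm]
  · have h' : ¬ P.up.Adj j i := fun e => h e.symm
    simp [sign, h, h']

theorem row_symm (m : ℤ) : P.row m j i = P.row m i j := by
  by_cases h : P.up.Adj i j
  · simp [row, h, h.symm, spineLength_comm j i]
  · have h' : ¬ P.up.Adj j i := fun e => h e.symm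
    simp [row, h, h', spineLength_comm j i]

theorem sign_eq : P.sign i j = 1 ∨ P.sign i j = -1 := by
  unfold sign; split_ifs <;> simp

theorem sign_mul_column_nonneg (a : ℤ) : 0 ≤ P.sign i j * (P.column a i j - P.center a i) := by
  by_cases hu : P.up.Adj i j <;> simp [sign, column, hu]

theorem spineLength_pos (h : i ≠ j) : 0 < spineLength i j := by
  refine abs_pos.2 fun e => h (Fin.ext ?_)
  omega

theorem row_mem {m : ℤ} (hm : 0 ≤ m) (h : P.up.Adj i j ∨ P.down.Adj i j) :
    1 ≤ P.row m i j ∧ P.row m i j ≤ P.downRows + m + P.upRows := by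
  by_cases hu : P.up.Adj i j
  · have := P.up_length i j hu
    have h0 := spineLength_pos hu.ne
    simp only [row, hu, if_true]; omega
  · have := P.down_length i j (h.resolve_left hu)
    simp only [row, hu, if_false]; omega

theorem row_beyond {m y : ℤ} (h : P.up.Adj i j ∨ P.down.Adj i j) (hy : P.downRows + 1 ≤ y)
    (hy' : y ≤ P.downRows + m) : 0 < P.sign i j * (P.row m i j - y) := by
  by_cases hu : P.up.Adj i j
  · have := spineLength_pos hu.ne
    simp only [row, sign, hu, if_true]; omega
  · have := P.down_length i j (h.resolve_left hu)
    simp only [row, sign, hu, if_false]; omega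

theorem nesting (a m : ℤ) (h : P.up.Adj i j ∨ P.down.Adj i j)
    (h' : P.up.Adj i' j' ∨ P.down.Adj i' j') (hne : s(i, j) ≠ s(i', j'))
    (hs : P.sign i j = P.sign i' j')
    (hr : P.sign i j * P.row m i' j' ≤ P.sign i j * P.row m i j) :
    P.column a i j ∉ Set.uIcc (P.column a i' j') (P.column a j' i') := by
  by_cases hu : P.up.Adj i j <;> by_cases hu' : P.up.Adj i' j' <;>
    simp only [sign, row, hu, hu', if_true, if_false] at hs hr <;> try omega
  · exact up_columns a hu hu' hne (by omega)
  · exact down_columns a (h.resolve_left hu) (h'.resolve_left hu') hu hu' hne (by omega)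

variable (P)

/-- The column layout of a spine drawing. The columns in use begin after the column `a`; the
vertical coordinates of the vertices and the rows around them are prescribed. -/
noncomputable def columnLayout (a m : ℤ) (Y yLo yHi : V → ℤ) (h₁ : ∀ u, yLo u + 1 ≤ Y u)
    (h₂ : ∀ u, Y u + 1 ≤ yHi u) (h₃ : ∀ u, P.downRows + 1 ≤ yLo u)
    (h₄ : ∀ u, yHi u ≤ P.downRows + m) : ColumnLayout G where
  X u := P.center a (P.spine u)
  Y u := Y u
  lo u := P.low a (P.spine u)
  hi u := P.high a (P.spine u)
  yLo u := yLo u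
  yHi u := yHi u
  col u v := P.column a (P.spine u) (P.spine v)
  far u v := P.row m (P.spine u) (P.spine v)
  side u v := P.sign (P.spine u) (P.spine v)
  lo_le u := mod_cast P.low_lt_center a _
  le_hi u := mod_cast P.center_lt_high a _
  yLo_le u := mod_cast h₁ u
  le_yHi u := mod_cast h₂ u
  sep u w hne := by
    rcases lt_or_gt_of_ne (fun e => hne (P.spine.injective e)) with h | h
    · left; exact_mod_cast P.high_lt_low a h
    · right; exact_mod_cast P.high_lt_low a h
  side_eq u v := mod_cast sign_eq
  side_symm u v := mod_cast sign_symm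
  far_symm u v := mod_cast row_symm m
  col_mem u v h := mod_cast column_mem a (P.up_or_down u v h)
  col_quadrant u v _ := mod_cast sign_mul_column_nonneg a
  col_inj u v w h h' hs hc := P.spine.injective
    (column_inj a (P.up_or_down u v h) (P.up_or_down u w h') (mod_cast hs) (mod_cast hc))
  far_beyond u v h w y hy hy' := by
    have h5 := row_beyond (P.up_or_down u v h) le_rfl
      (by linarith [h₁ w, h₂ w, h₃ w, h₄ w] : (P.downRows : ℤ) + 1 ≤ P.downRows + m)
    have h6 := row_beyond (m := m) (P.up_or_down u v h) (y := P.downRows + m)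
      (by linarith [h₁ w, h₂ w, h₃ w, h₄ w]) le_rfl
    have h7 : ((P.downRows : ℝ)) + 1 ≤ y := le_trans (mod_cast h₃ w) hy
    have h8 : y ≤ (P.downRows : ℝ) + m := le_trans hy' (mod_cast h₄ w)
    rcases sign_eq (P := P) (i := P.spine u) (j := P.spine v) with e | e <;> rw [e] at h5 h6 ⊢
    · have : (P.downRows : ℝ) + m < P.row m (P.spine u) (P.spine v) := by exact_mod_cast (by omega)
      push_cast; linarith
    · have : (P.row m (P.spine u) (P.spine v) : ℝ) < P.downRows + 1 := by exact_mod_cast (by omega)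
      push_cast; linarith
  nesting u v u' v' h h' hne hs hr := by
    have key := nesting (P := P) a m (P.up_or_down u v h) (P.up_or_down u' v' h')
      (fun e => hne ?_) (mod_cast hs) (mod_cast hr)
    · rw [Set.mem_uIcc] at key ⊢
      exact_mod_cast key
    · have := Sym2.map.injective P.spine.injective (a₁ := s(u, v)) (a₂ := s(u', v'))
      exact this (by simpa using e)

end SpineDrawing

theorem isGridPoint_intCast {w h : ℕ} {x y : ℤ} (hx : 1 ≤ x) (hx' : x ≤ w) (hy : 1 ≤ y)
    (hy' : y ≤ h) : IsGridPoint w h ((x : ℝ), (y : ℝ)) := by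
  lift x to ℕ using by omega
  lift y to ℕ using by omega
  exact ⟨x, y, by omega, by omega, by omega, by omega, by simp⟩

/-- Two spine drawings, one of them turned by a quarter, make a simultaneous drawing. The columns
that hold the vertices and the stems of one graph hold no bars of the other. -/
theorem exists_drawing_of_spineDrawing {V : Type*} {G₁ G₂ : SimpleGraph V} {k N : ℕ}
    (P₁ : SpineDrawing G₁ k) (P₂ : SpineDrawing G₂ k)
    (hN₁ : P₁.width + (P₂.downRows + P₂.upRows) ≤ N)
    (hN₂ : P₂.width + (P₁.downRows + P₁.upRows) ≤ N) :
    ∃ D : RacSimDrawing G₁ G₂, D.HasAtMostBends 4 ∧ D.IsOnGrid N N := by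
  set a₁ : ℤ := (P₂.downRows : ℤ) with ha₁
  set a₂ : ℤ := (P₁.upRows : ℤ) with ha₂
  set C : ℤ := (P₁.downRows : ℤ) + P₂.width + P₁.upRows + 1 with hC
  have A := fun u => P₁.low_lt_center a₁ (P₁.spine u)
  have B := fun u => P₁.center_lt_high a₁ (P₁.spine u)
  have A' := fun u => P₁.le_low a₁ (P₁.spine u)
  have B' := fun u => P₁.high_le a₁ (P₁.spine u)
  have E := fun u => P₂.low_lt_center a₂ (P₂.spine u)
  have F := fun u => P₂.center_lt_high a₂ (P₂.spine u)
  have E' := fun u => P₂.le_low a₂ (P₂.spine u)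
  have F' := fun u => P₂.high_le a₂ (P₂.spine u)
  let L₁ : ColumnLayout G₁ := P₁.columnLayout a₁ P₂.width
    (fun u => C - P₂.center a₂ (P₂.spine u)) (fun u => C - P₂.high a₂ (P₂.spine u))
    (fun u => C - P₂.low a₂ (P₂.spine u)) (fun u => by linarith [F u])
    (fun u => by linarith [E u]) (fun u => by linarith [F' u]) (fun u => by linarith [E' u])
  let L₂ : ColumnLayout G₂ := P₂.columnLayout a₂ P₁.width
    (fun u => P₁.center a₁ (P₁.spine u)) (fun u => P₁.low a₁ (P₁.spine u))
    (fun u => P₁.high a₁ (P₁.spine u)) A B A' B'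
  have hfit : ColumnLayout.Fits L₁ L₂ C :=
    ⟨fun u => by simp [L₁, L₂, SpineDrawing.columnLayout],
      fun u => by simp [L₁, L₂, SpineDrawing.columnLayout],
      fun u => by simp [L₁, L₂, SpineDrawing.columnLayout],
      fun u => by simp [L₁, L₂, SpineDrawing.columnLayout],
      fun u => by simp [L₁, L₂, SpineDrawing.columnLayout],
      fun u => by simp [L₁, L₂, SpineDrawing.columnLayout]⟩
  refine ⟨hfit.drawing, ⟨fun u v _ => ?_, fun u v _ => ?_⟩, fun u => ?_, fun u v huv p hp => ?_,
    fun u v huv p hp => ?_⟩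
  · exact le_rfl
  · simp [ColumnLayout.Fits.drawing, ColumnLayout.bends]
  · have := isGridPoint_intCast (w := N) (h := N) (x := P₁.center a₁ (P₁.spine u))
      (y := C - P₂.center a₂ (P₂.spine u)) (by linarith [A u, A' u])
      (by linarith [B u, B' u]) (by linarith [F u, F' u]) (by linarith [E u, E' u])
    exact this
  · have c1 := SpineDrawing.column_mem a₁ (P₁.up_or_down u v huv)
    have c2 := SpineDrawing.column_mem a₁ (P₁.up_or_down v u huv.symm)
    have r := SpineDrawing.row_mem (m := P₂.width) (by positivity) (P₁.up_or_down u v huv)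
    have s := SpineDrawing.sign_eq (P := P₁) (i := P₁.spine u) (j := P₁.spine v)
    have key : ∀ x y : ℤ, (x = P₁.column a₁ (P₁.spine u) (P₁.spine v) ∨
        x = P₁.column a₁ (P₁.spine v) (P₁.spine u)) →
        (y = P₁.row P₂.width (P₁.spine u) (P₁.spine v) ∨ ∃ w,
          y = C - P₂.center a₂ (P₂.spine w) + P₁.sign (P₁.spine u) (P₁.spine v)) →
        IsGridPoint N N ((x : ℝ), (y : ℝ)) := by
      rintro x y hx hy
      have hx' : 1 ≤ x ∧ x ≤ N := by
        rcases hx with rfl | rfl <;>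
          constructor <;> linarith [A' u, B' u, A' v, B' v]
      have hy' : 1 ≤ y ∧ y ≤ N := by
        rcases hy with rfl | ⟨w, rfl⟩
        · constructor <;> linarith
        · rcases s with e | e <;> rw [e] <;> constructor <;>
            linarith [E w, E' w, F w, F' w]
      exact isGridPoint_intCast hx'.1 hx'.2 hy'.1 hy'.2
    have hp' : p ∈ L₁.bends u v := hp
    simp only [ColumnLayout.bends, List.mem_cons, List.not_mem_nil, or_false] at hp'
    rcases hp' with rfl | rfl | rfl | rfl
    · have := key _ _ (Or.inl rfl) (Or.inr ⟨u, rfl⟩)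
      push_cast at this
      simpa [L₁, SpineDrawing.columnLayout] using this
    · exact key _ _ (Or.inl rfl) (Or.inl rfl)
    · exact key _ _ (Or.inr rfl) (Or.inl rfl)
    · have := key _ _ (Or.inr rfl) (Or.inr ⟨v, rfl⟩)
      push_cast at this
      simpa [L₁, SpineDrawing.columnLayout] using this
  · have c1 := SpineDrawing.column_mem a₂ (P₂.up_or_down u v huv)
    have c2 := SpineDrawing.column_mem a₂ (P₂.up_or_down v u huv.symm)
    have r := SpineDrawing.row_mem (m := P₁.width) (by positivity) (P₂.up_or_down u v huv)
    have s := SpineDrawing.sign_eq (P := P₂) (i := P₂.spine u) (j := P₂.spine v)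
    have key : ∀ x y : ℤ, (x = P₂.column a₂ (P₂.spine u) (P₂.spine v) ∨
        x = P₂.column a₂ (P₂.spine v) (P₂.spine u)) →
        (y = P₂.row P₁.width (P₂.spine u) (P₂.spine v) ∨ ∃ w,
          y = P₁.center a₁ (P₁.spine w) + P₂.sign (P₂.spine u) (P₂.spine v)) →
        IsGridPoint N N (quarterTurn C ((x : ℝ), (y : ℝ))) := by
      rintro x y hx hy
      have hx' : 1 ≤ C - x ∧ C - x ≤ N := by
        rcases hx with rfl | rfl <;>
          constructor <;> linarith [E' u, F' u, E' v, F' v]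
      have hy' : 1 ≤ y ∧ y ≤ N := by
        rcases hy with rfl | ⟨w, rfl⟩
        · constructor <;> linarith
        · rcases s with e | e <;> rw [e] <;> constructor <;>
            linarith [A w, A' w, B w, B' w]
      have := isGridPoint_intCast hy'.1 hy'.2 hx'.1 hx'.2
      simpa [quarterTurn] using this
    have hp' : p ∈ (L₂.bends u v).map (quarterTurn C) := hp
    simp only [ColumnLayout.bends, List.map_cons, List.map_nil, List.mem_cons, List.not_mem_nil,
      or_false] at hp'
    rcases hp' with rfl | rfl | rfl | rfl
    · have := key _ _ (Or.inl rfl) (Or.inr ⟨u, rfl⟩)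
      push_cast at this
      simpa [L₂, SpineDrawing.columnLayout] using this
    · exact key _ _ (Or.inl rfl) (Or.inl rfl)
    · exact key _ _ (Or.inr rfl) (Or.inl rfl)
    · have := key _ _ (Or.inr rfl) (Or.inr ⟨v, rfl⟩)
      push_cast at this
      simpa [L₂, SpineDrawing.columnLayout] using this

/-! ### Counting the edges of noncrossing graphs -/

section Counting

open Classical in
/-- The edges of a graph on `Fin k`, as pairs in increasing order. -/
noncomputable def orderedEdges {k : ℕ} (T : SimpleGraph (Fin k)) : Finset (Fin k × Fin k) :=
  {p | p.1 < p.2 ∧ T.Adj p.1 p.2}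

variable {k : ℕ} {T : SimpleGraph (Fin k)}

theorem mem_orderedEdges {p : Fin k × Fin k} :
    p ∈ orderedEdges T ↔ p.1 < p.2 ∧ T.Adj p.1 p.2 := by
  simp [orderedEdges]

theorem deg_eq_card [DecidableRel T.Adj] (i : Fin k) :
    deg T i = (Finset.univ.filter (T.Adj i)).card := by
  rw [deg, ← Set.ncard_coe_finset]
  congr 1
  ext j
  simp

theorem sum_deg : ∑ i, deg T i = 2 * (orderedEdges T).card := by
  classical
  have h1 : (orderedEdges T).card = ∑ i, ∑ j, if i < j ∧ T.Adj i j then 1 else 0 := by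
    rw [orderedEdges, Finset.card_filter, Fintype.sum_prod_type]
  have h2 : (orderedEdges T).card = ∑ i, ∑ j, if j < i ∧ T.Adj i j then 1 else 0 := by
    rw [h1, Finset.sum_comm]
    simp only [T.adj_comm]
  rw [two_mul]
  nth_rewrite 1 [h1]
  rw [h2, ← Finset.sum_add_distrib]
  refine Finset.sum_congr rfl fun i _ => ?_
  rw [deg_eq_card, Finset.card_filter, ← Finset.sum_add_distrib]
  refine Finset.sum_congr rfl fun j _ => ?_
  by_cases h : T.Adj i j
  · rcases lt_or_gt_of_ne h.ne with h' | h' <;> simp [h, h', h'.not_gt]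
  · simp [h]

theorem deg_le_card_orderedEdges (i : Fin k) : deg T i ≤ (orderedEdges T).card := by
  classical
  rw [deg_eq_card]
  refine Finset.card_le_card_of_injOn (fun j => (min i j, max i j)) (fun j hj => ?_) ?_
  · have hj : T.Adj i j := by simpa using hj
    simp only [Finset.mem_coe, mem_orderedEdges]
    rcases lt_or_gt_of_ne hj.ne with h | h
    · simpa [min_eq_left h.le, max_eq_right h.le, h] using hj
    · simpa [min_eq_right h.le, max_eq_left h.le, h] using hj.symm
  · intro j hj j' hj' h
    simp only [Prod.mk.injEq] at h
    rcases le_total i j with a | a <;> rcases le_total i j' with b | b <;> simp [a, b] at h <;> grind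

/-- Noncrossing diagonals of a convex polygon with `k` vertices, including the one side that joins
the first to the last vertex, are at most `k - 2`. A diagonal from `i` to `j` is sent to the last
vertex before `j` that is joined to `i` by a diagonal, or to `i + 1` if there is none. -/
theorem card_add_two_le (hk : 2 ≤ k) (S : Finset (Fin k × Fin k))
    (hS : ∀ p ∈ S, (p.1 : ℕ) + 2 ≤ p.2)
    (hcross : ∀ p ∈ S, ∀ q ∈ S, p.1 < q.1 → q.1 < p.2 → p.2 < q.2 → False) :
    S.card + 2 ≤ k := by
  classical
  have key : ∀ p : Fin k × Fin k, ∃ l : Fin k, p ∈ S → (p.1 < l ∧ l < p.2) ∧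
      ((l : ℕ) = p.1 + 1 ∨ (p.1, l) ∈ S) ∧ ∀ m, (p.1, m) ∈ S → m < p.2 → m ≤ l := by
    intro p
    by_cases hp : p ∈ S
    swap
    · exact ⟨p.1, fun h => absurd h hp⟩
    have h1 := hS p hp
    have h2 := p.2.2
    obtain ⟨l, hl, hmax⟩ := Finset.exists_max_image
      (insert (⟨p.1 + 1, by omega⟩ : Fin k)
        (Finset.univ.filter fun m => (p.1, m) ∈ S ∧ m < p.2)) id ⟨_, Finset.mem_insert_self _ _⟩
    refine ⟨l, fun _ => ⟨?_, ?_, fun m hm hm' => ?_⟩⟩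
    · rcases Finset.mem_insert.1 hl with rfl | hl
      · simp only [Fin.lt_def]; omega
      · have hl' := (Finset.mem_filter.1 hl).2
        have := hS _ hl'.1
        refine ⟨?_, hl'.2⟩
        simp only [Fin.lt_def] at this ⊢; omega
    · rcases Finset.mem_insert.1 hl with rfl | hl
      · exact Or.inl rfl
      · exact Or.inr (Finset.mem_filter.1 hl).2.1
    · exact hmax m (Finset.mem_insert_of_mem (Finset.mem_filter.2 ⟨Finset.mem_univ _, hm, hm'⟩))
  choose f hf using key
  have hle : S.card ≤ (Finset.Ioo 0 (k - 1)).card := by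
    refine Finset.card_le_card_of_injOn (fun p => (f p : ℕ)) (fun p hp => ?_) ?_
    · have h1 := (hf p hp).1
      have h2 := p.2.2
      simp only [Fin.lt_def] at h1
      simp only [Finset.coe_Ioo, Set.mem_Ioo]
      omega
    · have main : ∀ p ∈ S, ∀ q ∈ S, f p = f q → p ≠ q → p.1 ≤ q.1 →
          (p.1 = q.1 → q.2 < p.2) → False := by
        intro p hp q hq hpq hne hle hlt
        obtain ⟨⟨a1, a2⟩, a3, a4⟩ := hf p hp
        obtain ⟨⟨b1, b2⟩, b3, b4⟩ := hf q hq
        rcases eq_or_lt_of_le hle with h | h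
        · have := a4 q.2 (by rw [h]; exact hq) (hlt h)
          rw [hpq] at this
          exact absurd this (not_le.2 b2)
        · rcases a3 with a3 | a3
          · rw [hpq] at a3
            simp only [Fin.lt_def] at h b1; omega
          · rw [hpq] at a3
            exact hcross _ a3 q hq h b1 b2
      intro p hp q hq hpq
      have hpq : f p = f q := Fin.ext hpq
      by_contra hne
      rcases lt_trichotomy p.1 q.1 with h | h | h
      · exact main p hp q hq hpq hne h.le (fun e => absurd e h.ne)
      · rcases lt_trichotomy p.2 q.2 with h' | h' | h'
        · exact main q hq p hp hpq.symm (Ne.symm hne) h.ge (fun _ => h')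
        · exact hne (Prod.ext h h')
        · exact main p hp q hq hpq hne h.le (fun _ => h')
      · exact main q hq p hp hpq.symm (Ne.symm hne) h.le (fun e => absurd e h.ne)
  rw [Nat.card_Ioo] at hle
  omega

/-- A noncrossing graph on `k` vertices on one side of the spine has at most `2 k - 3` edges. -/
theorem card_orderedEdges_le (hk : 2 ≤ k) (hT : Noncrossing T) :
    (orderedEdges T).card + 3 ≤ 2 * k := by
  classical
  rw [← Finset.card_filter_add_card_filter_not (s := orderedEdges T)
    (fun p => (p.1 : ℕ) + 1 = p.2)]
  have h1 : ((orderedEdges T).filter fun p => (p.1 : ℕ) + 1 = p.2).card ≤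
      (Finset.range (k - 1)).card := by
    refine Finset.card_le_card_of_injOn (fun p => (p.1 : ℕ)) (fun p hp => ?_) ?_
    · have h := (Finset.mem_filter.1 hp).2
      have := p.2.2
      simp only [Finset.coe_range, Set.mem_Iio]; omega
    · intro p hp q hq h
      have h1 := (Finset.mem_filter.1 hp).2
      have h2 := (Finset.mem_filter.1 hq).2
      simp only at h
      exact Prod.ext (Fin.ext h) (Fin.ext (by omega))
  have h2 := card_add_two_le hk ((orderedEdges T).filter fun p => ¬ (p.1 : ℕ) + 1 = p.2)
    (fun p hp => by
      have h := Finset.mem_filter.1 hp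
      have h' := (mem_orderedEdges.1 h.1).1
      simp only [Fin.lt_def] at h'
      omega)
    (fun p hp q hq => hT _ _ _ _ (mem_orderedEdges.1 (Finset.mem_filter.1 hp).1).2
      (mem_orderedEdges.1 (Finset.mem_filter.1 hq).1).2)
  rw [Finset.card_range] at h1
  omega

/-- A noncrossing graph on `k` vertices without the sides of the convex polygon has at most `k - 3`
edges. -/
theorem card_orderedEdges_diagonals_le (hk : 3 ≤ k) (hT : Noncrossing T)
    (hlen : ∀ i j, T.Adj i j → 2 ≤ spineLength i j ∧ spineLength i j + 2 ≤ k) :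
    (orderedEdges T).card + 3 ≤ k := by
  classical
  have hl : ∀ p ∈ orderedEdges T, (p.1 : ℕ) + 2 ≤ p.2 ∧ (p.2 : ℕ) + 2 ≤ p.1 + k := by
    intro p hp
    have h := mem_orderedEdges.1 hp
    have h' := hlen _ _ h.2
    simp only [Fin.lt_def] at h
    rw [spineLength, abs_of_pos (by omega)] at h'
    omega
  let e : Fin k × Fin k := (⟨0, by omega⟩, ⟨k - 1, by omega⟩)
  have he : e ∉ orderedEdges T := by
    intro h
    have := (hl e h).2
    simp only [e] at this
    omega
  have h2 := card_add_two_le (by omega) (insert e (orderedEdges T))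
    (fun p hp => by
      rcases Finset.mem_insert.1 hp with rfl | hp
      · simp only [e]; omega
      · exact (hl p hp).1)
    (fun p hp q hq h1 h2 h3 => by
      rcases Finset.mem_insert.1 hp with rfl | hp
      · have := q.2.2
        simp only [e, Fin.lt_def] at h1 h2 h3; omega
      rcases Finset.mem_insert.1 hq with rfl | hq
      · simp only [e, Fin.lt_def] at h1 h2 h3; omega
      exact hT _ _ _ _ (mem_orderedEdges.1 hp).2 (mem_orderedEdges.1 hq).2 h1 h2 h3)
  rw [Finset.card_insert_of_notMem he] at h2
  omega

end Counting

/-! ### Spine drawings of small width -/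

theorem IsBookEmbeddable.exists_spine {V : Type*} [Fintype V] {G : SimpleGraph V} {n : ℕ}
    (hV : Fintype.card V = n) (h : IsBookEmbeddable G 2) :
    ∃ (spine : V ≃ Fin n) (page : Sym2 V → Fin 2), ∀ a b c d, G.Adj a b → G.Adj c d →
      spine a < spine c → spine c < spine b → spine b < spine d → page s(a, b) ≠ page s(c, d) := by
  subst hV
  exact h

/-- The sides of the convex polygon on `Fin k`, and the edges of the first page. -/
def cyclePage {V : Type*} {k : ℕ} (G : SimpleGraph V) (spine : V ≃ Fin k) (page : Sym2 V → Fin 2) :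
    SimpleGraph (Fin k) where
  Adj i j := i ≠ j ∧ (spineLength i j = 1 ∨ spineLength i j = k - 1 ∨
    G.Adj (spine.symm i) (spine.symm j) ∧ page s(spine.symm i, spine.symm j) = 0)
  symm := ⟨fun i j h => ⟨h.1.symm, by
    rw [spineLength_comm j i, G.adj_comm, Sym2.eq_swap]; exact h.2⟩⟩
  loopless := ⟨fun _ h => h.1 rfl⟩

/-- The edges of the second page that are not sides of the convex polygon on `Fin k`. -/
def diagonalPage {V : Type*} {k : ℕ} (G : SimpleGraph V) (spine : V ≃ Fin k)
    (page : Sym2 V → Fin 2) : SimpleGraph (Fin k) where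
  Adj i j := G.Adj (spine.symm i) (spine.symm j) ∧ page s(spine.symm i, spine.symm j) = 1 ∧
    spineLength i j ≠ 1 ∧ spineLength i j ≠ k - 1
  symm := ⟨fun i j h => by rwa [spineLength_comm j i, G.adj_comm, Sym2.eq_swap]⟩
  loopless := ⟨fun _ h => h.1.ne rfl⟩

/-- The spine drawing of a graph with at least six vertices: all sides of the convex polygon are
drawn above the spine, so that only diagonals remain below. -/
theorem exists_spineDrawing_of_six_le {V : Type*} {n : ℕ} (hn : 6 ≤ n)
    {G : SimpleGraph V} (spine : V ≃ Fin n) (page : Sym2 V → Fin 2)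
    (hpage : ∀ a b c d, G.Adj a b → G.Adj c d →
      spine a < spine c → spine c < spine b → spine b < spine d → page s(a, b) ≠ page s(c, d)) :
    ∃ P : SpineDrawing G n, P.width + 28 ≤ 9 * n ∧ P.downRows + P.upRows + 4 ≤ 2 * n := by
  have hlt : ∀ i j : Fin n, spineLength i j ≤ n - 1 := by
    intro i j
    have := i.2
    have := j.2
    unfold spineLength
    rcases abs_cases ((j : ℤ) - i) with ⟨e, _⟩ | ⟨e, _⟩ <;> omega
  have hside : ∀ a b c d : Fin n, a < c → c < b → b < d →
      1 < spineLength a b ∧ spineLength a b < n - 1 ∧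
      1 < spineLength c d ∧ spineLength c d < n - 1 := by
    intro a b c d h1 h2 h3
    have := d.2
    simp only [Fin.lt_def] at h1 h2 h3
    unfold spineLength
    rw [abs_of_pos (by omega), abs_of_pos (by omega)]
    omega
  have hup : Noncrossing (cyclePage G spine page) := by
    rintro a b c d ⟨-, hab⟩ ⟨-, hcd⟩ h1 h2 h3
    obtain ⟨l1, l2, l3, l4⟩ := hside a b c d h1 h2 h3
    rcases hab with hab | hab | hab
    · omega
    · omega
    rcases hcd with hcd | hcd | hcd
    · omega
    · omega
    exact hpage _ _ _ _ hab.1 hcd.1 (by simpa) (by simpa) (by simpa) (hab.2.trans hcd.2.symm)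
  have hdown : Noncrossing (diagonalPage G spine page) := by
    rintro a b c d ⟨hab, pab, -, -⟩ ⟨hcd, pcd, -, -⟩ h1 h2 h3
    exact hpage _ _ _ _ hab hcd (by simpa) (by simpa) (by simpa) (pab.trans pcd.symm)
  have hlen : ∀ i j, (diagonalPage G spine page).Adj i j →
      2 ≤ spineLength i j ∧ spineLength i j + 2 ≤ n := by
    intro i j h
    have h0 := SpineDrawing.spineLength_pos h.ne
    have h1 := hlt i j
    have h2 := h.2.2
    omega
  let P : SpineDrawing G n :=
    { spine := spine
      up := cyclePage G spine page
      down := diagonalPage G spine page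
      upRows := n - 1
      downRows := n - 3
      skip := 1
      up_noncrossing := hup
      down_noncrossing := hdown
      up_or_down := by
        intro u v huv
        have hne : spine u ≠ spine v := fun e => huv.ne (spine.injective e)
        by_cases h1 : spineLength (spine u) (spine v) = 1
        · exact Or.inl ⟨hne, Or.inl h1⟩
        by_cases h2 : spineLength (spine u) (spine v) = n - 1
        · exact Or.inl ⟨hne, Or.inr (Or.inl h2)⟩
        rcases Fin.exists_fin_two.1 ⟨page s(u, v), rfl⟩ with h3 | h3
        · exact Or.inl ⟨hne, Or.inr (Or.inr (by simpa using ⟨huv, h3⟩))⟩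
        · exact Or.inr ⟨by simpa using huv, by simpa using h3, h1, h2⟩
      up_length := by
        intro i j _
        have := hlt i j
        omega
      down_length := by
        intro i j h
        have := hlen i j h
        omega }
  refine ⟨P, ?_, by simp only [P]; omega⟩
  have cu : (orderedEdges P.up).card + 3 ≤ 2 * n := card_orderedEdges_le (by omega) hup
  have cd : (orderedEdges P.down).card + 3 ≤ n :=
    card_orderedEdges_diagonals_le (by omega) hdown hlen
  have su := sum_deg (T := P.up)
  have sd := sum_deg (T := P.down)
  have two_le : ∀ i, 2 ≤ deg P.up i := by
    intro i
    have hi := i.2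
    refine (Set.one_lt_ncard_iff (Set.toFinite _)).2
      ⟨if h : (i : ℕ) + 1 < n then ⟨i + 1, h⟩ else ⟨0, by omega⟩,
        if h : 0 < (i : ℕ) then ⟨i - 1, by omega⟩ else ⟨n - 1, by omega⟩, ?_, ?_, ?_⟩
    · refine ⟨?_, ?_⟩
      · intro e
        have := congrArg Fin.val e
        split_ifs at this <;> (simp at this; try omega)
      · split_ifs with h
        · left; simp [spineLength]
        · right; left
          simp only [spineLength, Nat.cast_zero, zero_sub, abs_neg, Nat.abs_cast]; omega
    · refine ⟨?_, ?_⟩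
      · intro e
        have := congrArg Fin.val e
        split_ifs at this <;> simp at this <;> omega
      · split_ifs with h
        · left
          rw [spineLength_comm, spineLength, abs_of_pos] <;> push_cast [h] <;> omega
        · right; left
          rw [spineLength, abs_of_pos] <;> simp only [] <;> omega
    · intro e
      have := congrArg Fin.val e
      split_ifs at this <;> simp at this <;> omega
  have sr : ∑ i, P.right i + n = 2 * (orderedEdges P.up).card := by
    have : ∑ i, (P.right i + 1) = ∑ i, deg P.up i := by
      refine Finset.sum_congr rfl fun i _ => ?_
      have := two_le i
      unfold SpineDrawing.right; omega
    rw [Finset.sum_add_distrib, su] at this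
    simpa using this
  -- A vertex of degree `b` on the lower page takes `max 1 (b - 1)` columns on the left. As a
  -- function of `b` this is at most the linear function with value `1` at `b = 0` and `n - 4` at
  -- the largest possible degree `b = n - 3`.
  obtain ⟨m, rfl⟩ : ∃ m, n = m + 6 := ⟨n - 6, by omega⟩
  have sl : (m + 3) * ∑ i, P.left i ≤ (m + 3) * (3 * m + 8) := by
    calc (m + 3) * ∑ i, P.left i = ∑ i, (m + 3) * P.left i := Finset.mul_sum _ _ _
      _ ≤ ∑ i, ((m + 3) + (m + 1) * deg P.down i) := by
          refine Finset.sum_le_sum fun i _ => ?_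
          have h1 := deg_le_card_orderedEdges (T := P.down) i
          unfold SpineDrawing.left
          rcases le_total (deg P.down i) 2 with h2 | h2
          · rw [max_eq_left (by omega)]; omega
          · obtain ⟨b, hb⟩ := Nat.exists_eq_add_of_le h2
            rw [hb, max_eq_right (by omega), show 2 + b - 1 = b + 1 by omega]
            nlinarith
      _ = (m + 6) * (m + 3) + (m + 1) * (2 * (orderedEdges P.down).card) := by
          rw [Finset.sum_add_distrib, ← Finset.mul_sum, sd]; simp
      _ ≤ (m + 6) * (m + 3) + (m + 1) * (2 * (m + 3)) := by
          gcongr; omega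
      _ = (m + 3) * (3 * m + 8) := by ring
  have sl' := Nat.le_of_mul_le_mul_left sl (by omega)
  have hw : P.width = (m + 6) + ∑ i, P.left i + ∑ i, P.right i := by
    simp [SpineDrawing.width, SpineDrawing.cols, Finset.sum_add_distrib]
  omega

/-- The upper page of the drawing of the complete graph on five vertices without the edge `03`. -/
def fiveUp : SimpleGraph (Fin 5) :=
  SimpleGraph.fromRel fun i j => (i, j) ∈ [((0 : Fin 5), (1 : Fin 5)), (1, 2), (3, 4), (0, 2), (2, 4)]

/-- The lower page of the drawing of the complete graph on five vertices without the edge `03`. -/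
def fiveDown : SimpleGraph (Fin 5) :=
  SimpleGraph.fromRel fun i j => (i, j) ∈ [((2 : Fin 5), (3 : Fin 5)), (1, 3), (1, 4), (0, 4)]

instance : DecidableRel fiveUp.Adj := fun i j => by
  unfold fiveUp SimpleGraph.fromRel; infer_instance

instance : DecidableRel fiveDown.Adj := fun i j => by
  unfold fiveDown SimpleGraph.fromRel; infer_instance

/-- On five vertices in convex position, the five diagonals cross each other in an odd cycle, so
that one of them is missing. The spine can be turned so that this is the edge `03`. -/
theorem exists_spineDrawing_of_five {V : Type*} {G : SimpleGraph V} (spine : V ≃ Fin 5)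
    (page : Sym2 V → Fin 2) (hpage : ∀ a b c d, G.Adj a b → G.Adj c d →
      spine a < spine c → spine c < spine b → spine b < spine d → page s(a, b) ≠ page s(c, d)) :
    ∃ P : SpineDrawing G 5, P.width + 28 ≤ 9 * 5 ∧ P.downRows + P.upRows + 4 ≤ 2 * 5 := by
  obtain ⟨d, hd⟩ : ∃ d : Fin 5, ¬ G.Adj (spine.symm d) (spine.symm (d + 3)) := by
    by_contra! hall
    have h : ∀ a b c d : Fin 5, G.Adj (spine.symm a) (spine.symm b) →
        G.Adj (spine.symm c) (spine.symm d) → a < c → c < b → b < d →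
        page s(spine.symm a, spine.symm b) ≠ page s(spine.symm c, spine.symm d) :=
      fun a b c d hab hcd h1 h2 h3 => hpage _ _ _ _ hab hcd (by simpa) (by simpa) (by simpa)
    have a03 := hall 0
    have a14 := hall 1
    have a02 := (hall 2).symm
    have a13 := (hall 3).symm
    have a24 := (hall 4).symm
    have e1 := h 0 2 1 3 a02 a13 (by decide) (by decide) (by decide)
    have e2 := h 1 3 2 4 a13 a24 (by decide) (by decide) (by decide)
    have e3 := h 0 3 2 4 a03 a24 (by decide) (by decide) (by decide)
    have e4 := h 0 3 1 4 a03 a14 (by decide) (by decide) (by decide)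
    have e5 := h 0 2 1 4 a02 a14 (by decide) (by decide) (by decide)
    generalize page s(spine.symm 0, spine.symm 2) = p02 at *
    generalize page s(spine.symm 0, spine.symm 3) = p03 at *
    generalize page s(spine.symm 1, spine.symm 3) = p13 at *
    generalize page s(spine.symm 1, spine.symm 4) = p14 at *
    generalize page s(spine.symm 2, spine.symm 4) = p24 at *
    omega
  let P : SpineDrawing G 5 :=
    { spine := spine.trans (Equiv.subRight d)
      up := fiveUp
      down := fiveDown
      upRows := 2
      downRows := 4
      skip := 0
      up_noncrossing := by unfold Noncrossing; decide
      down_noncrossing := by unfold Noncrossing; decide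
      up_or_down := by
        intro u v huv
        have key : ∀ i j : Fin 5, i ≠ j → ¬ (j = i + 3 ∧ i = 0) → ¬ (i = j + 3 ∧ j = 0) →
            fiveUp.Adj i j ∨ fiveDown.Adj i j := by decide
        refine key _ _ (fun e => huv.ne ?_) (fun e => hd ?_) (fun e => hd ?_)
        · exact (spine.trans (Equiv.subRight d)).injective e
        · have h1 : spine u = d := sub_eq_zero.1 e.2
          have h2 : spine v = d + 3 := by
            have := e.1
            simp only [Equiv.trans_apply, Equiv.subRight_apply, h1, sub_self, zero_add] at this
            rw [← this]; abel
          rw [← h2, ← h1]; simpa using huv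
        · have h1 : spine v = d := sub_eq_zero.1 e.2
          have h2 : spine u = d + 3 := by
            have := e.1
            simp only [Equiv.trans_apply, Equiv.subRight_apply, h1, sub_self, zero_add] at this
            rw [← this]; abel
          rw [← h2, ← h1]; simpa using huv.symm
      up_length := by unfold spineLength; decide
      down_length := by unfold spineLength; decide }
  refine ⟨P, ?_, by simp [P]⟩
  simp only [P, SpineDrawing.width, SpineDrawing.cols, SpineDrawing.left, SpineDrawing.right,
    deg_eq_card]
  decide

theorem exists_spineDrawing {V : Type*} [Fintype V] {n : ℕ} (hn : 5 ≤ n)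
    (hV : Fintype.card V = n) {G : SimpleGraph V} (h : IsBookEmbeddable G 2) :
    ∃ P : SpineDrawing G n, P.width + 28 ≤ 9 * n ∧ P.downRows + P.upRows + 4 ≤ 2 * n := by
  obtain ⟨spine, page, hpage⟩ := h.exists_spine hV
  rcases eq_or_lt_of_le hn with rfl | hn
  · exact exists_spineDrawing_of_five spine page hpage
  · exact exists_spineDrawing_of_six_le hn spine page hpage

/-! ### Four vertices -/

/-- The point of the plane with the given integer coordinates. -/
def latticePoint (a : ℤ × ℤ) : Plane := ((a.1 : ℝ), (a.2 : ℝ))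

/-- Twice the signed area of the triangle `abc`. -/
def signedArea (a b c : ℤ × ℤ) : ℤ := (b.1 - a.1) * (c.2 - a.2) - (b.2 - a.2) * (c.1 - a.1)

/-- A certificate that the segments `ab` and `cd` meet in a point of `W` at most: one of them lies
strictly on one side of the line through the other, or they are not parallel and have a common end
in `W`. -/
def MeetWithin (W : List (ℤ × ℤ)) (s t : (ℤ × ℤ) × (ℤ × ℤ)) : Prop :=
  0 < signedArea s.1 s.2 t.1 * signedArea s.1 s.2 t.2 ∨
  0 < signedArea t.1 t.2 s.1 * signedArea t.1 t.2 s.2 ∨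
  (s.1 = t.1 ∧ signedArea s.1 s.2 t.2 ≠ 0 ∧ s.1 ∈ W) ∨
  (s.1 = t.2 ∧ signedArea s.1 s.2 t.1 ≠ 0 ∧ s.1 ∈ W) ∨
  (s.2 = t.1 ∧ signedArea s.2 s.1 t.2 ≠ 0 ∧ s.2 ∈ W) ∨
  (s.2 = t.2 ∧ signedArea s.2 s.1 t.1 ≠ 0 ∧ s.2 ∈ W)

instance (W : List (ℤ × ℤ)) (s t : (ℤ × ℤ) × (ℤ × ℤ)) : Decidable (MeetWithin W s t) := by
  unfold MeetWithin; infer_instance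

theorem latticePoint_injective : Function.Injective latticePoint := by
  intro a b h
  have h1 := congrArg Prod.fst h
  have h2 := congrArg Prod.snd h
  simp only [latticePoint] at h1 h2
  exact Prod.ext (mod_cast h1) (mod_cast h2)

theorem not_mem_segment_of_signedArea_pos {a b c d : ℤ × ℤ} {x : Plane}
    (h : 0 < signedArea a b c * signedArea a b d)
    (hx : x ∈ segment ℝ (latticePoint a) (latticePoint b))
    (hx' : x ∈ segment ℝ (latticePoint c) (latticePoint d)) : False := by
  obtain ⟨t, -, -, h3, h4⟩ := mem_segment_coord.1 hx
  obtain ⟨r, r0, r1, h5, h6⟩ := mem_segment_coord.1 hx'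
  simp only [latticePoint] at h3 h4 h5 h6
  have h' : (0 : ℝ) < (signedArea a b c : ℝ) * (signedArea a b d : ℝ) := by exact_mod_cast h
  have e : (1 - r) * (signedArea a b c : ℝ) + r * (signedArea a b d : ℝ) = 0 := by
    simp only [signedArea]
    push_cast
    have e1 : ((b.1 : ℝ) - a.1) * (x.2 - a.2) - (b.2 - a.2) * (x.1 - a.1) = 0 := by
      rw [h3, h4]; ring
    rw [h5, h6] at e1
    linear_combination e1
  rcases pos_and_pos_or_neg_and_neg_of_mul_pos h' with ⟨p, q⟩ | ⟨p, q⟩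
  · rcases eq_or_lt_of_le r0 with rfl | r0
    · linarith
    · nlinarith [mul_pos r0 q, mul_nonneg (sub_nonneg.2 r1) p.le]
  · rcases eq_or_lt_of_le r0 with rfl | r0
    · linarith
    · nlinarith [mul_neg_of_pos_of_neg r0 q, mul_nonpos_of_nonneg_of_nonpos (sub_nonneg.2 r1) p.le]

theorem eq_of_mem_segments_of_signedArea_ne_zero {a b d : ℤ × ℤ} {x : Plane}
    (h : signedArea a b d ≠ 0) (hx : x ∈ segment ℝ (latticePoint a) (latticePoint b))
    (hx' : x ∈ segment ℝ (latticePoint a) (latticePoint d)) : x = latticePoint a := by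
  obtain ⟨t, -, -, h3, h4⟩ := mem_segment_coord.1 hx
  obtain ⟨r, -, -, h5, h6⟩ := mem_segment_coord.1 hx'
  simp only [latticePoint] at h3 h4 h5 h6
  have h' : (signedArea a b d : ℝ) ≠ 0 := by exact_mod_cast h
  have e : r * (signedArea a b d : ℝ) = 0 := by
    simp only [signedArea]
    push_cast
    have e1 : ((b.1 : ℝ) - a.1) * (x.2 - a.2) - (b.2 - a.2) * (x.1 - a.1) = 0 := by
      rw [h3, h4]; ring
    rw [h5, h6] at e1
    linear_combination e1
  have hr := (mul_eq_zero.1 e).resolve_right h'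
  rw [hr] at h5 h6
  exact Prod.ext (by simp [latticePoint, h5]) (by simp [latticePoint, h6])

theorem MeetWithin.exists_mem {W : List (ℤ × ℤ)} {s t : (ℤ × ℤ) × (ℤ × ℤ)} (h : MeetWithin W s t)
    {x : Plane} (hx : x ∈ segment ℝ (latticePoint s.1) (latticePoint s.2))
    (hx' : x ∈ segment ℝ (latticePoint t.1) (latticePoint t.2)) :
    ∃ w ∈ W, x = latticePoint w := by
  obtain ⟨a, b⟩ := s
  obtain ⟨c, d⟩ := t
  unfold MeetWithin at h
  simp only at h hx hx'
  rcases h with h | h | ⟨rfl, h, hW⟩ | ⟨rfl, h, hW⟩ | ⟨rfl, h, hW⟩ | ⟨rfl, h, hW⟩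
  · exact (not_mem_segment_of_signedArea_pos h hx hx').elim
  · exact (not_mem_segment_of_signedArea_pos h hx' hx).elim
  · exact ⟨_, hW, eq_of_mem_segments_of_signedArea_ne_zero h hx hx'⟩
  · rw [segment_symm] at hx'
    exact ⟨_, hW, eq_of_mem_segments_of_signedArea_ne_zero h hx hx'⟩
  · rw [segment_symm] at hx
    exact ⟨_, hW, eq_of_mem_segments_of_signedArea_ne_zero h hx hx'⟩
  · rw [segment_symm] at hx hx'
    exact ⟨_, hW, eq_of_mem_segments_of_signedArea_ne_zero h hx hx'⟩

theorem not_mem_segment_of_signedArea_ne_zero {a b c : ℤ × ℤ} (h : signedArea a b c ≠ 0) :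
    latticePoint c ∉ segment ℝ (latticePoint a) (latticePoint b) := by
  intro hx
  obtain ⟨t, -, -, h3, h4⟩ := mem_segment_coord.1 hx
  simp only [latticePoint] at h3 h4
  apply h
  have : (signedArea a b c : ℝ) = 0 := by
    simp only [signedArea]; push_cast; rw [h3, h4]; ring
  exact_mod_cast this

/-- The vertices of a triangle and a point inside it. -/
def fourPoint : Fin 4 → ℤ × ℤ := ![(2, 2), (11, 2), (2, 11), (4, 4)]

/-- A bend for every two of the four points, such that the straight segments between the points
and the polylines with these bends make a planar drawing of the doubled complete graph. The entries
on the diagonal have no meaning. -/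
def fourBend : Fin 4 → Fin 4 → ℤ × ℤ :=
  ![![(1, 1), (6, 1), (1, 6), (4, 3)], ![(6, 1), (1, 1), (12, 12), (7, 4)],
    ![(1, 6), (12, 12), (1, 1), (3, 5)], ![(4, 3), (7, 4), (3, 5), (1, 1)]]

/-- The list of bends of the edge `ij` in the straight and in the bent drawing. -/
def fourBends (bent : Bool) (i j : Fin 4) : List (ℤ × ℤ) := if bent then [fourBend i j] else []

/-- The segments of the edge `ij` in the straight and in the bent drawing. -/
def fourSegments (bent : Bool) (i j : Fin 4) : List ((ℤ × ℤ) × (ℤ × ℤ)) :=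
  if bent then [(fourPoint i, fourBend i j), (fourBend i j, fourPoint j)]
  else [(fourPoint i, fourPoint j)]

set_option synthInstance.maxHeartbeats 400000 in
set_option synthInstance.maxSize 1000 in
set_option maxRecDepth 100000 in
theorem fourSegments_meet : ∀ b b' : Bool, ∀ i j i' j' : Fin 4, i ≠ j → i' ≠ j' →
    ¬ (b = b' ∧ (i = i' ∧ j = j' ∨ i = j' ∧ j = i')) →
    ∀ s ∈ fourSegments b i j, ∀ t ∈ fourSegments b' i' j',
      MeetWithin (([i, j].filter (· ∈ [i', j'])).map fourPoint) s t := by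
  decide

theorem fourSegments_avoid : ∀ b : Bool, ∀ i j l : Fin 4, i ≠ j → l ≠ i → l ≠ j →
    ∀ s ∈ fourSegments b i j, signedArea s.1 s.2 (fourPoint l) ≠ 0 := by
  decide

section Four

variable {V : Type*} (e : V ≃ Fin 4)

/-- The placement of four vertices. -/
def fourPos (v : V) : Plane := latticePoint (fourPoint (e v))

/-- The bends of the edges between four vertices. -/
def fourEdgeBends (bent : Bool) (u v : V) : List Plane :=
  (fourBends bent (e u) (e v)).map latticePoint

variable {e}

theorem exists_fourSegment {bent : Bool} {u v : V} {x : Plane}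
    (hx : x ∈ polyTrace (edgePolyline (fourPos e) (fourEdgeBends e bent) u v)) :
    ∃ s ∈ fourSegments bent (e u) (e v),
      x ∈ segment ℝ (latticePoint s.1) (latticePoint s.2) := by
  cases bent
  · simp only [edgePolyline, fourEdgeBends, fourBends, fourPos, Bool.false_eq_true, if_false,
      List.map_nil, List.nil_append, polyTrace, Set.mem_union, Set.mem_singleton_iff] at hx
    refine ⟨_, List.mem_singleton.2 rfl, ?_⟩
    rcases hx with hx | rfl
    · exact hx
    · exact right_mem_segment ℝ _ _
  · simp only [edgePolyline, fourEdgeBends, fourBends, fourPos, if_true, List.map_cons,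
      List.map_nil, List.cons_append, List.nil_append, polyTrace, Set.mem_union,
      Set.mem_singleton_iff] at hx
    rcases hx with hx | hx | rfl
    · exact ⟨(fourPoint (e u), fourBend (e u) (e v)), by simp [fourSegments], hx⟩
    · exact ⟨(fourBend (e u) (e v), fourPoint (e v)), by simp [fourSegments], hx⟩
    · exact ⟨(fourBend (e u) (e v), fourPoint (e v)), by simp [fourSegments],
        right_mem_segment ℝ _ _⟩

theorem four_meet {b b' : Bool} {u v u' v' : V} (huv : u ≠ v) (huv' : u' ≠ v')
    (hne : ¬ (b = b' ∧ s(u, v) = s(u', v'))) {x : Plane}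
    (hx : x ∈ polyTrace (edgePolyline (fourPos e) (fourEdgeBends e b) u v))
    (hx' : x ∈ polyTrace (edgePolyline (fourPos e) (fourEdgeBends e b') u' v')) :
    ∃ w, w ∈ s(u, v) ∧ w ∈ s(u', v') ∧ x = fourPos e w := by
  obtain ⟨s, hs, hxs⟩ := exists_fourSegment hx
  obtain ⟨t, ht, hxt⟩ := exists_fourSegment hx'
  have h := fourSegments_meet b b' (e u) (e v) (e u') (e v') (fun h => huv (e.injective h))
    (fun h => huv' (e.injective h)) (fun h => hne ⟨h.1, by simpa using h.2⟩) s hs t ht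
  obtain ⟨p, hp, rfl⟩ := h.exists_mem hxs hxt
  obtain ⟨l, hl, rfl⟩ := List.mem_map.1 hp
  refine ⟨e.symm l, ?_, ?_, by simp [fourPos]⟩ <;>
    simp only [List.mem_filter, List.mem_cons, List.not_mem_nil, or_false, decide_eq_true_eq] at hl
  · rcases hl.1 with rfl | rfl <;> simp
  · rcases hl.2 with h | h <;> simp [h]

theorem four_planar (G : SimpleGraph V) (b : Bool) :
    IsPlanarPolylineDrawing G (fourPos e) (fourEdgeBends e b) where
  pos_injective := by
    have : Function.Injective fourPoint := by decide
    exact latticePoint_injective.comp (this.comp e.injective)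
  bends_symm u v _ := by
    have : ∀ i j, fourBend i j = fourBend j i := by decide
    cases b
    · rfl
    · simp [fourEdgeBends, fourBends, this (e u)]
  simple u v huv := by
    have hne : e u ≠ e v := fun h => huv.ne (e.injective h)
    cases b
    · have h : ∀ i j, i ≠ j → fourPoint i ≠ fourPoint j := by decide
      refine ⟨fun h' => h _ _ hne (latticePoint_injective h'), fun x _ hx => hx, trivial⟩
    · have h : ∀ i j, i ≠ j → fourPoint i ≠ fourBend i j ∧ fourBend i j ≠ fourPoint j ∧
          signedArea (fourBend i j) (fourPoint i) (fourPoint j) ≠ 0 := by decide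
      obtain ⟨h1, h2, h3⟩ := h _ _ hne
      refine ⟨fun h' => h1 (latticePoint_injective h'), fun x hx hx' => ?_,
        fun h' => h2 (latticePoint_injective h'), fun x _ hx => hx, trivial⟩
      refine eq_of_mem_segments_of_signedArea_ne_zero h3 (by rwa [segment_symm]) ?_
      rcases hx' with hx' | hx'
      · exact hx'
      · rw [Set.mem_singleton_iff.1 hx']
        exact right_mem_segment ℝ _ _
  vertex_on_edge u v w huv hw := by
    by_contra! hc
    obtain ⟨s, hs, hx⟩ := exists_fourSegment hw
    exact not_mem_segment_of_signedArea_ne_zero (fourSegments_avoid b (e u) (e v) (e w)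
      (fun h => huv.ne (e.injective h)) (fun h => hc.1 (e.injective h))
      (fun h => hc.2 (e.injective h)) s hs) hx
  edges_disjoint u v u' v' huv huv' hne x hx hx' :=
    four_meet huv.ne huv'.ne (fun h => hne h.2) hx hx'

/-- On four vertices, both graphs can be drawn without any crossings, one with straight edges, the
other with one bend per edge. -/
theorem exists_drawing_of_four (e : V ≃ Fin 4) (G₁ G₂ : SimpleGraph V) :
    ∃ D : RacSimDrawing G₁ G₂, D.HasAtMostBends 4 ∧ D.IsOnGrid 12 12 := by
  have hmeet : ∀ u v u' v', G₁.Adj u v → G₂.Adj u' v' →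
      ∀ x, x ∈ polyTrace (edgePolyline (fourPos e) (fourEdgeBends e false) u v) →
        x ∈ polyTrace (edgePolyline (fourPos e) (fourEdgeBends e true) u' v') →
        (∃ w, w ∈ s(u, v) ∧ w ∈ s(u', v') ∧ x = fourPos e w) ∨
          IsRightAngleCrossing (edgePolyline (fourPos e) (fourEdgeBends e false) u v)
            (edgePolyline (fourPos e) (fourEdgeBends e true) u' v') x :=
    fun u v u' v' huv huv' x hx hx' =>
      Or.inl (four_meet huv.ne huv'.ne (fun h => Bool.false_ne_true h.1) hx hx')
  refine ⟨⟨fourPos e, fourEdgeBends e false, fourEdgeBends e true, four_planar G₁ false,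
    four_planar G₂ true, no_overlap_of_right_angle hmeet, hmeet⟩,
    ⟨fun u v _ => by simp [fourEdgeBends, fourBends], fun u v _ => by
      simp [fourEdgeBends, fourBends]⟩, fun v => ?_, fun u v _ p hp => ?_, fun u v _ p hp => ?_⟩
  · have h : ∀ i, 1 ≤ (fourPoint i).1 ∧ (fourPoint i).1 ≤ 12 ∧ 1 ≤ (fourPoint i).2 ∧
        (fourPoint i).2 ≤ 12 := by decide
    obtain ⟨h1, h2, h3, h4⟩ := h (e v)
    exact isGridPoint_intCast h1 h2 h3 h4
  · simp [fourEdgeBends, fourBends] at hp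
  · have h : ∀ i j, 1 ≤ (fourBend i j).1 ∧ (fourBend i j).1 ≤ 12 ∧ 1 ≤ (fourBend i j).2 ∧
        (fourBend i j).2 ≤ 12 := by decide
    obtain ⟨h1, h2, h3, h4⟩ := h (e u) (e v)
    have hp : p = latticePoint (fourBend (e u) (e v)) := by
      simpa [fourEdgeBends, fourBends] using hp
    rw [hp]
    exact isGridPoint_intCast h1 h2 h3 h4

end Four

theorem corollary2 {V : Type*} [Fintype V] (n : ℕ) (hn : 4 ≤ n) (hV : Fintype.card V = n)
    (G₁ G₂ : SimpleGraph V) (h₁ : IsBookEmbeddable G₁ 2) (h₂ : IsBookEmbeddable G₂ 2) :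
    ∃ D : RacSimDrawing G₁ G₂,
      D.HasAtMostBends 4 ∧ D.IsOnGrid (11 * n - 32) (11 * n - 32) := by
  rcases eq_or_lt_of_le hn with rfl | hn
  · exact exists_drawing_of_four (Fintype.equivFinOfCardEq hV) G₁ G₂
  · obtain ⟨P₁, w₁, r₁⟩ := exists_spineDrawing hn hV h₁
    obtain ⟨P₂, w₂, r₂⟩ := exists_spineDrawing hn hV h₂
    exact exists_drawing_of_spineDrawing P₁ P₂ (by omega) (by omega)
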